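/- **Setting.** Let $d\in\{2,3\}$. Let $\mathbf F$ be a $C^1$ diffeomorphism with bounded Jacobian $\mathbf J$ of $\hat\Omega=(-1,1)^d$ onto a domain $\Omega\subset\mathbb R^d$, let $\mathcal M$ be a partition of $\hat\Omega$ into finitely many open boxes $Q$ with diagonal $h_Q$, and let $\Omega_K=\mathbf F(Q)$ be the physical elements, $h_K^2=\tfrac{h_Q^2}{d}\|\mathbf J\|_F^2$. Let $\mathcal V^h$ (velocities), $\mathcal Q^h$ (pressures) and $\mathcal S^h$ (scalars) be finite-dimensional spaces of functions such that: elements of $\mathcal V^h$ and $\mathcal S^h$ are Lipschitz on $\overline\Omega$ and $C^2$ with bounded derivatives on each $\Omega_K$; elements of $\mathcal Q^h$ are $C^1$ with bounded derivatives on each $\Omega_K$ and have zero average over $\Omega$; velocities vanish on $\partial\Omega$; and the spaces are divergence-conforming, $\nabla\cdot\mathcal V^h\subseteq\mathcal Q^h$. Write $(\cdot,\cdot)_D$ for the $L^2(D)$ inner product. Fix $\rho_1\ge\rho_2>0$, $\mu_1,\mu_2>0$, $\mathrm{Re},\mathrm{We},\mathrm{Fr}>0$, $\varepsilon>0$, $\epsilon\ge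 0$, $\mathcal C\ge 0$, a unit vector $\boldsymbol\jmath$, and $y=\mathbf x\cdot\boldsymbol\jmath$. Let $H_\varepsilon(\phi)=H^p(\phi/\varepsilon)$ with $H^p(z)=0$ for $z<-1$, $H^p(z)=1$ for $z\ge1$, and $$H^p(z)=-\tfrac34z^5\mp\tfrac52z^4-\tfrac52z^3+\tfrac54z+\tfrac12$$ with the sign $-$ for $-1\le z<0$ and $+$ for $0\le z<1$. Put $\delta=\delta_\varepsilon=H_\varepsilon'$, $\rho(\phi)=\rho_1H_\varepsilon(\phi)+\rho_2(1-H_\varepsilon(\phi))$, $\mu(\phi)=\mu_1H_\varepsilon(\phi)+\mu_2(1-H_\varepsilon(\phi))$, $\boldsymbol\tau(\mathbf u,\phi)=\tfrac1{\mathrm{Re}}\mu(\phi)(\nabla\mathbf u+\nabla^T\mathbf u)$, and $\|\mathbf b\|_{\epsilon,2}=(\mathbf b\cdot\mathbf b+\epsilon^2)^{1/2}$ (for matrices with the Frobenius product). If $\epsilon=0$, quotients $0/0$ are read as $0$. For levels $n,n+1$ with $\Delta t_n=t_{n+1}-t_n>0$ write $[\![a]\!]=a_{n+1}-a_n$, $\mathbf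 u_{n+1/2}=\tfrac12(\mathbf u_n+\mathbf u_{n+1})$, $\phi_{n+1/2}=\tfrac12(\phi_n+\phi_{n+1})$, $\rho_n=\rho(\phi_n)$, $\rho_{n+1/2}=\rho(\phi_{n+1/2})$, while $(\nabla\phi)_{n+1/2}$, $(\|\nabla\phi\|_{\epsilon,2})_{n+1/2}$, $(\delta(\phi))_{n+1/2}$ are the averages of the values at levels $n$ and $n+1$. Let $\varrho_m=(\rho_1-\rho_2)H_\varepsilon'(\phi_{n+1/2})$. Pointwise, if $\phi_n$ and $\phi_{n+1}$ lie in the same of the four pieces of $H_\varepsilon$, put $$\varrho_a=(\rho_1-\rho_2)\Big(H_\varepsilon^{(1)}+\tfrac1{24}H_\varepsilon^{(3)}[\![\phi]\!]^2+\tfrac1{1920}H_\varepsilon^{(5)}[\![\phi]\!]^4\Big)(\phi_{n+1/2}),\qquad \varsigma=\Big(\delta^{(1)}+\tfrac{[\![\phi]\!]^2}{24}\delta^{(3)}\Big)(\phi_{n+1/2}),$$ and otherwise $\varrho_a=[\![\rho(\phi)]\!]/[\![\phi]\!]$, $\varsigma=[\![\delta(\phi)]\!]/[\![\phi]\!]$.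 (Derivatives of $H_\varepsilon$ that do not exist at a breakpoint are always multiplied by $0$ in these formulas; they are read as $0$.) Let $\mathscr R_I=[\![\phi]\!]/\Delta t_n+\mathbf u_{n+1/2}\cdot\nabla\phi_{n+1/2}$, let $\tau_K$ be arbitrary real-valued stabilization parameters on the elements (they may depend on $n$ and on the solution; an integral of a non-integrable function is read as $0$), and let $\theta_K=\mathcal C\,h_K\,\|\boldsymbol{\mathscr R}_M\|_{\epsilon,2}/\|\nabla\mathbf u_{n+1/2}\|_{\epsilon,2}$, where, elementwise and with $\mathbf u=\mathbf u_{n+1/2}$, $\phi=\phi_{n+1/2}$, $$\boldsymbol{\mathscr R}_M=\frac{[\![\rho\mathbf u]\!]}{\Delta t_n}+\nabla\cdot(\rho(\phi)\mathbf u\otimes\mathbf u)-\nabla\cdot\boldsymbol\tau(\mathbf u,\phi)+\nabla p_{n+1}+\frac1{\mathrm{We}}\delta(\phi)\,\nabla\cdot\Big(\frac{\nabla\phi}{\|\nabla\phi\|_{\epsilon,2}}\Big)\nabla\phi+\frac1{\mathrm{Fr}^2}\rho(\phi)\boldsymbol\jmath .$$ **Scheme.** Given $(\mathbf u_n,p_n,\phi_n,v_n)\in\mathcal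 V^h\times\mathcal Q^h\times\mathcal S^h\times\mathcal S^h$, the state $(\mathbf u_{n+1},p_{n+1},\phi_{n+1},v_{n+1})$ in the same space satisfies, for all $\mathbf w\in\mathcal V^h$, $q\in\mathcal Q^h$, $\psi,\zeta\in\mathcal S^h$, $$\begin{aligned} &\Big(\mathbf w,\tfrac{[\![\rho\mathbf u]\!]}{\Delta t_n}\Big)_\Omega-(\nabla\mathbf w,\rho_{n+1/2}\mathbf u_{n+1/2}\otimes\mathbf u_{n+1/2})_\Omega-(\nabla\cdot\mathbf w,p_{n+1})_\Omega+(\nabla\mathbf w,\boldsymbol\tau(\mathbf u_{n+1/2},\phi_{n+1/2}))_\Omega\\ &\quad+\tfrac1{\mathrm{Fr}^2}(\mathbf w,\rho_{n+1/2}\boldsymbol\jmath)_\Omega-(\mathbf w,v_{n+1}\nabla\phi_{n+1/2})_\Omega-\Big(\mathbf w,\varrho_m\big(\tfrac12\|\mathbf u_{n+1/2}\|_2^2-\tfrac1{\mathrm{Fr}^2}y\big)\nabla\phi_{n+1/2}\Big)_\Omega\\ &\quad+\sum_K(\nabla\mathbf w,\theta_K\nabla\mathbf u_{n+1/2})_{\Omega_K}-\sum_K(\tau_K\mathbf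 w\cdot\nabla v_{n+1},\mathscr R_I)_{\Omega_K}=0,\\ &(q,\nabla\cdot\mathbf u_{n+1/2})_\Omega=0,\\ &\Big(\psi,\tfrac{[\![\phi]\!]}{\Delta t_n}+\mathbf u_{n+1/2}\cdot\nabla\phi_{n+1/2}\Big)_\Omega+\sum_K(\tau_K\mathbf u_{n+1/2}\cdot\nabla\psi,\mathscr R_I)_{\Omega_K}=0,\\ &\Big(\zeta,v_{n+1}+\varrho_a\big(\tfrac12\mathbf u_{n+1}\cdot\mathbf u_n-\tfrac1{\mathrm{Fr}^2}y\big)\Big)_\Omega-\tfrac1{\mathrm{We}}\big(\zeta\varsigma,(\|\nabla\phi\|_{\epsilon,2})_{n+1/2}\big)_\Omega-\tfrac1{\mathrm{We}}\Big((\delta(\phi))_{n+1/2}\nabla\zeta,\tfrac{(\nabla\phi)_{n+1/2}}{(\|\nabla\phi\|_{\epsilon,2})_{n+1/2}}\Big)_\Omega=0. \end{aligned}$$ Define the energy at level $n$ by $\mathscr E_n=(\tfrac12\rho_n\mathbf u_n,\mathbf u_n)_\Omega+\tfrac1{\mathrm{Fr}^2}(\rho_n,y)_\Omega+\tfrac1{\mathrm{We}}(1,\delta(\phi_n)\|\nabla\phi_n\|_{\epsilon,2})_\Omega$.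 **Theorem.** Let $(\mathbf u_n,p_n,\phi_n,v_n)_{n=0}^{N+1}$ be states in the discrete spaces, each obtained from the preceding one by a step of the scheme, with arbitrary time steps $\Delta t_n>0$, $n=0,\dots,N$. Then: 1. $\rho_2\le\rho(\phi_n)\le\rho_1$ in $\Omega$ for all $n=0,\dots,N+1$. 2. For all $n=0,\dots,N$, $\nabla\cdot\mathbf u_{n+1/2}=0$ pointwise in every element $\Omega_K$ and at every point of $\Omega$ near which $\mathbf u_{n+1/2}$ is continuously differentiable, and $\nabla\cdot\mathbf u_{n+1/2}=0$ in the sense of distributions on $\Omega$. 3. For all $n=0,\dots,N$, $$\frac{\mathscr E_{n+1}-\mathscr E_n}{\Delta t_n}=-\big(\nabla\mathbf u_{n+1/2},\boldsymbol\tau(\mathbf u_{n+1/2},\phi_{n+1/2})\big)_\Omega-\sum_K\big(\nabla\mathbf u_{n+1/2},\theta_K\nabla\mathbf u_{n+1/2}\big)_{\Omega_K}\le0 .$$ -/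

import Mathlib

open MeasureTheory
open scoped ContDiff NNReal

namespace LevelSetNS

noncomputable section

/-! ### Vector calculus on `ℝ^d` -/

/-- Euclidean space `ℝ^d`. -/
abbrev E (d : ℕ) := EuclideanSpace ℝ (Fin d)

/-- The standard inner product `a · b`. -/
abbrev dot {d : ℕ} (a b : E d) : ℝ := inner ℝ a b

/-- The matrix `(∇u)_{ij} = ∂_j u_i` of a vector field at a point. -/
def grad {d : ℕ} (u : E d → E d) (x : E d) : Matrix (Fin d) (Fin d) ℝ :=
  Matrix.of fun i j => (fderiv ℝ u x (EuclideanSpace.single j 1)) i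

/-- The divergence `∇ · u = ∑ᵢ ∂ᵢ uᵢ`. -/
def divg {d : ℕ} (u : E d → E d) (x : E d) : ℝ := (grad u x).trace

/-- The divergence of a tensor field, `(∇ · T)_i = ∑_j ∂_j T_{ij}`. -/
def divTensor {d : ℕ} (T : E d → Matrix (Fin d) (Fin d) ℝ) (x : E d) : E d :=
  WithLp.toLp 2 fun i => ∑ j, fderiv ℝ (fun z => T z i j) x (EuclideanSpace.single j 1)

/-- The double contraction `A : B = ∑_{ij} A_{ij} B_{ij}`. -/
def contract {d : ℕ} (A B : Matrix (Fin d) (Fin d) ℝ) : ℝ := ∑ i, ∑ j, A i j * B i j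

/-- The tensor product `a ⊗ b`. -/
def outer {d : ℕ} (a b : E d) : Matrix (Fin d) (Fin d) ℝ := Matrix.of fun i j => a i * b j

/-- The regularized norm of a vector, `‖b‖_{ϵ,2}² = b · b + ϵ²`. -/
def regNorm {d : ℕ} (ϵ : ℝ) (b : E d) : ℝ := √(dot b b + ϵ ^ 2)

/-- The regularized norm of a matrix, `‖A‖_{ϵ,2}² = A : A + ϵ²`. -/
def regNormMat {d : ℕ} (ϵ : ℝ) (A : Matrix (Fin d) (Fin d) ℝ) : ℝ := √(contract A A + ϵ ^ 2)

/-! ### The regularized Heaviside function -/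

/-- The piecewise polynomial regularization `H^p` of the Heaviside function. -/
def Hp (z : ℝ) : ℝ :=
  if z < -1 then 0
  else if z < 0 then
    -(3 / 4) * z ^ 5 - (5 / 2) * z ^ 4 - (5 / 2) * z ^ 3 + (5 / 4) * z + 1 / 2
  else if z < 1 then
    -(3 / 4) * z ^ 5 + (5 / 2) * z ^ 4 - (5 / 2) * z ^ 3 + (5 / 4) * z + 1 / 2
  else 1

/-- `H_ε(φ) = H^p(φ / ε)`. -/
def Heps (ε φ : ℝ) : ℝ := Hp (φ / ε)

/-- The regularized Dirac delta `δ_ε = H_ε'`. -/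
def deltaEps (ε φ : ℝ) : ℝ := deriv (Heps ε) φ

/-- The index of the piece of the piecewise polynomial `H_ε` to which `φ` belongs. -/
def piece (ε φ : ℝ) : Fin 4 :=
  if φ / ε < -1 then 0 else if φ / ε < 0 then 1 else if φ / ε < 1 then 2 else 3

/-! ### Physical and numerical constants -/

/-- Densities, viscosities, the Reynolds, Weber and Froude numbers, the interface width `ε`, the
regularization `ϵ` of the norm, the discontinuity-capturing constant `𝒞` and the vertical unit
vector `𝒿`. The fluids are numbered such that `ρ₂ ≤ ρ₁`. -/
structure Params (d : ℕ) where
  ρ₁ : ℝ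
  ρ₂ : ℝ
  μ₁ : ℝ
  μ₂ : ℝ
  Re : ℝ
  We : ℝ
  Fr : ℝ
  ε : ℝ
  ϵ : ℝ
  C : ℝ
  jvec : E d
  ρ₂_pos : 0 < ρ₂
  ρ₂_le_ρ₁ : ρ₂ ≤ ρ₁
  μ₁_pos : 0 < μ₁
  μ₂_pos : 0 < μ₂
  Re_pos : 0 < Re
  We_pos : 0 < We
  Fr_pos : 0 < Fr
  ε_pos : 0 < ε
  ϵ_nonneg : 0 ≤ ϵ
  C_nonneg : 0 ≤ C
  norm_jvec : ‖jvec‖ = 1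

namespace Params

variable {d : ℕ} (P : Params d)

/-- The vertical coordinate `y = x · 𝒿`. -/
def y (x : E d) : ℝ := dot x P.jvec

/-- The density `ρ(φ) = ρ₁ H_ε(φ) + ρ₂ (1 - H_ε(φ))`. -/
def rho (φ : ℝ) : ℝ := P.ρ₁ * Heps P.ε φ + P.ρ₂ * (1 - Heps P.ε φ)

/-- The viscosity `μ(φ) = μ₁ H_ε(φ) + μ₂ (1 - H_ε(φ))`. -/
def mu (φ : ℝ) : ℝ := P.μ₁ * Heps P.ε φ + P.μ₂ * (1 - Heps P.ε φ)

/-- The viscous stress `𝛕(u, φ) = Re⁻¹ μ(φ) (∇u + ∇ᵀu)`. -/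
def stress (u : E d → E d) (φ : E d → ℝ) (x : E d) : Matrix (Fin d) (Fin d) ℝ :=
  (1 / P.Re * P.mu (φ x)) • (grad u x + (grad u x).transpose)

/-- The curvature `κ(φ) = ∇ · (∇φ / ‖∇φ‖_{ϵ,2})`. -/
def curvature (φ : E d → ℝ) (x : E d) : ℝ :=
  divg (fun z => (1 / regNorm P.ϵ (gradient φ z)) • gradient φ z) x

/-- `ϱ_m = (ρ₁ - ρ₂) H_ε'(φ_{n+1/2})`, used in the momentum equation. The argument is the value
of the level-set function at the intermediate level. -/
def varrhoM (φh : ℝ) : ℝ := (P.ρ₁ - P.ρ₂) * deriv (Heps P.ε) φh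

/-- The truncated Taylor series `ϱ_T`, with `a = φ_n` and `b = φ_{n+1}`. -/
def varrhoT (a b : ℝ) : ℝ :=
  (P.ρ₁ - P.ρ₂) * (iteratedDeriv 1 (Heps P.ε) ((a + b) / 2)
    + 1 / 24 * iteratedDeriv 3 (Heps P.ε) ((a + b) / 2) * (b - a) ^ 2
    + 1 / 1920 * iteratedDeriv 5 (Heps P.ε) ((a + b) / 2) * (b - a) ^ 4)

/-- The divided difference `ϱ_F`, with `a = φ_n` and `b = φ_{n+1}`. -/
def varrhoF (a b : ℝ) : ℝ := (P.rho b - P.rho a) / (b - a)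

/-- `ϱ_a`, used in the auxiliary equation: the truncated series if both values lie in the same
piece of `H_ε`, and the divided difference otherwise. -/
def varrhoA (a b : ℝ) : ℝ := if piece P.ε a = piece P.ε b then P.varrhoT a b else P.varrhoF a b

/-- The truncated Taylor series `ς_T`, with `a = φ_n` and `b = φ_{n+1}`. -/
def varsigmaT (a b : ℝ) : ℝ :=
  iteratedDeriv 1 (deltaEps P.ε) ((a + b) / 2)
    + (b - a) ^ 2 / 24 * iteratedDeriv 3 (deltaEps P.ε) ((a + b) / 2)

/-- The divided difference `ς_F`, with `a = φ_n` and `b = φ_{n+1}`. -/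
def varsigmaF (a b : ℝ) : ℝ := (deltaEps P.ε b - deltaEps P.ε a) / (b - a)

/-- `ς`: the truncated series if both values lie in the same piece of `H_ε`, and the divided
difference otherwise. -/
def varsigma (a b : ℝ) : ℝ :=
  if piece P.ε a = piece P.ε b then P.varsigmaT a b else P.varsigmaF a b

end Params

/-! ### The isogeometric mesh -/

/-- The parametric domain `(-1, 1)^d`. -/
def refCube (d : ℕ) : Set (E d) := {ξ | ∀ i, ξ i ∈ Set.Ioo (-1 : ℝ) 1}

/-- The open box with corners `a` and `b`. -/
def openBox {d : ℕ} (a b : E d) : Set (E d) := {ξ | ∀ i, ξ i ∈ Set.Ioo (a i) (b i)}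

/-- A partition of the parametric domain into finitely many open boxes, and the geometrical map
`F`, a `C¹` diffeomorphism with bounded Jacobian of the parametric domain onto the physical
domain. -/
structure Mesh (d : ℕ) where
  numElem : ℕ
  lo : Fin numElem → E d
  hi : Fin numElem → E d
  lo_lt_hi : ∀ K i, lo K i < hi K i
  subset : ∀ K, openBox (lo K) (hi K) ⊆ refCube d
  disjoint : ∀ K L, K ≠ L → Disjoint (openBox (lo K) (hi K)) (openBox (lo L) (hi L))
  cover : ∀ ξ ∈ refCube d, ∃ K, ∀ i, ξ i ∈ Set.Icc (lo K i) (hi K i)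
  F : OpenPartialHomeomorph (E d) (E d)
  source_eq : F.source = refCube d
  contDiffOn_F : ContDiffOn ℝ 1 F F.source
  contDiffOn_symm : ContDiffOn ℝ 1 F.symm F.target
  bounded_jacobian : ∃ c : ℝ, ∀ ξ ∈ F.source, ‖fderiv ℝ F ξ‖ ≤ c

namespace Mesh

variable {d : ℕ} (M : Mesh d)

/-- The physical domain `Ω = F((-1, 1)^d)`. -/
def Ω : Set (E d) := M.F.target

/-- The (open) physical element `Ω_K = F(Q)`. -/
def elem (K : Fin M.numElem) : Set (E d) := M.F '' openBox (M.lo K) (M.hi K)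

/-- The Jacobian `J = ∂x/∂ξ` at the physical point `x`. -/
def jacobian (x : E d) : Matrix (Fin d) (Fin d) ℝ := grad M.F (M.F.symm x)

/-- The physical mesh size, `h_K² = (h_Q² / d) ‖J‖_F²` with `h_Q` the diagonal length of `Q`. -/
def meshSize (K : Fin M.numElem) (x : E d) : ℝ :=
  √(‖M.hi K - M.lo K‖ ^ 2 / d * contract (M.jacobian x) (M.jacobian x))

/-- `f` is of class `C^k`, with bounded derivatives up to order `k`, on each element. -/
def PiecewiseCk {G : Type*} [NormedAddCommGroup G] [NormedSpace ℝ G] (k : ℕ) (f : E d → G) :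
    Prop :=
  ∀ K, ContDiffOn ℝ k f (M.elem K) ∧
    ∀ m ≤ k, ∃ c : ℝ, ∀ x ∈ M.elem K, ‖iteratedFDeriv ℝ m f x‖ ≤ c

end Mesh

/-! ### Divergence-conforming discrete spaces -/

/-- Finite-dimensional spaces of piecewise `C²` (pressures: `C¹`) functions on the mesh:
a space `V` of Lipschitz velocities that vanish on `∂Ω`, a space `Q` of zero-average pressures and
a space `S` of Lipschitz scalar fields (level-set functions and auxiliary variables) with
`∇ · V ⊆ Q`. Only the values in the closure of `Ω` play a role. -/
structure DivConformingSpaces {d : ℕ} (M : Mesh d) where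
  V : Submodule ℝ (E d → E d)
  Q : Submodule ℝ (E d → ℝ)
  S : Submodule ℝ (E d → ℝ)
  finite_V : FiniteDimensional ℝ V
  finite_Q : FiniteDimensional ℝ Q
  finite_S : FiniteDimensional ℝ S
  lipschitz_V : ∀ u ∈ V, ∃ L : ℝ≥0, LipschitzOnWith L u (closure M.Ω)
  lipschitz_S : ∀ f ∈ S, ∃ L : ℝ≥0, LipschitzOnWith L f (closure M.Ω)
  piecewise_V : ∀ u ∈ V, M.PiecewiseCk 2 u
  piecewise_S : ∀ f ∈ S, M.PiecewiseCk 2 f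
  piecewise_Q : ∀ q ∈ Q, M.PiecewiseCk 1 q
  boundary_V : ∀ u ∈ V, ∀ x ∈ frontier M.Ω, u x = 0
  average_Q : ∀ q ∈ Q, ∫ x in M.Ω, q x = 0
  div_V : ∀ u ∈ V, ∃ q ∈ Q, ∀ K, ∀ x ∈ M.elem K, q x = divg u x

/-! ### The fully-discrete scheme -/

/-- The unknowns at one time level: velocity, pressure, level-set function, auxiliary variable. -/
structure State (d : ℕ) where
  u : E d → E d
  p : E d → ℝ
  φ : E d → ℝ
  v : E d → ℝ

/-- The unknowns belong to the discrete spaces. -/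
def State.Mem {d : ℕ} {M : Mesh d} (X : DivConformingSpaces M) (s : State d) : Prop :=
  s.u ∈ X.V ∧ s.p ∈ X.Q ∧ s.φ ∈ X.S ∧ s.v ∈ X.S

/-- `u_{n+1/2} = (u_n + u_{n+1}) / 2`. -/
def uMid {d : ℕ} (s s' : State d) : E d → E d := fun x => (1 / 2 : ℝ) • (s.u x + s'.u x)

/-- `φ_{n+1/2} = (φ_n + φ_{n+1}) / 2`. -/
def φMid {d : ℕ} (s s' : State d) : E d → ℝ := fun x => (1 / 2 : ℝ) * (s.φ x + s'.φ x)

/-- The difference quotient `[[ρ u]]_{n+1/2} / Δt = (ρ_{n+1} u_{n+1} - ρ_n u_n) / Δt`. -/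
def momentumRate {d : ℕ} (P : Params d) (Δt : ℝ) (s s' : State d) (x : E d) : E d :=
  (1 / Δt) • (P.rho (s'.φ x) • s'.u x - P.rho (s.φ x) • s.u x)

/-- The level-set residual `R_I φ_{n+1/2} = [[φ]]_{n+1/2} / Δt + u_{n+1/2} · ∇φ_{n+1/2}`. -/
def levelSetResidual {d : ℕ} (Δt : ℝ) (s s' : State d) (x : E d) : ℝ :=
  (s'.φ x - s.φ x) / Δt + dot (uMid s s' x) (gradient (φMid s s') x)

/-- The conservative momentum residual `R_M` at the intermediate time level. -/
def momentumResidual {d : ℕ} (P : Params d) (Δt : ℝ) (s s' : State d) (x : E d) : E d :=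
  momentumRate P Δt s s' x
    + divTensor (fun z => P.rho (φMid s s' z) • outer (uMid s s' z) (uMid s s' z)) x
    - divTensor (P.stress (uMid s s') (φMid s s')) x
    + gradient s'.p x
    + (1 / P.We * deltaEps P.ε (φMid s s' x) * P.curvature (φMid s s') x) •
        gradient (φMid s s') x
    + (1 / P.Fr ^ 2 * P.rho (φMid s s' x)) • P.jvec

/-- The discontinuity-capturing viscosity
`θ_K = 𝒞 h_K ‖R_M‖_{ϵ,2} / ‖∇u_{n+1/2}‖_{ϵ,2}`. -/
def theta {d : ℕ} (P : Params d) (M : Mesh d) (Δt : ℝ) (s s' : State d)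
    (K : Fin M.numElem) (x : E d) : ℝ :=
  P.C * M.meshSize K x * regNorm P.ϵ (momentumResidual P Δt s s' x)
    / regNormMat P.ϵ (grad (uMid s s') x)

/-- `(‖∇φ‖_{ϵ,2})_{n+1/2}`, the average of the two regularized norms. -/
def gradNormAvg {d : ℕ} (P : Params d) (s s' : State d) (x : E d) : ℝ :=
  (1 / 2) * (regNorm P.ϵ (gradient s.φ x) + regNorm P.ϵ (gradient s'.φ x))

/-- `(∇φ)_{n+1/2}`, the average of the two gradients. -/
def gradAvg {d : ℕ} (s s' : State d) (x : E d) : E d :=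
  (1 / 2 : ℝ) • (gradient s.φ x + gradient s'.φ x)

/-- `(δ(φ))_{n+1/2}`, the average of the two values. -/
def deltaAvg {d : ℕ} (P : Params d) (s s' : State d) (x : E d) : ℝ :=
  (1 / 2) * (deltaEps P.ε (s.φ x) + deltaEps P.ε (s'.φ x))

/-- One step of the fully-discrete scheme with time step `Δt`, from the state `s` at level `n` to
the state `s'` at level `n + 1`. The functions `τ K` are the SUPG parameters of the elements;
nothing is assumed about them. -/
structure IsStep {d : ℕ} (P : Params d) {M : Mesh d} (X : DivConformingSpaces M) (Δt : ℝ)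
    (τ : Fin M.numElem → E d → ℝ) (s s' : State d) : Prop where
  momentum : ∀ w ∈ X.V,
    (∫ x in M.Ω, dot (w x) (momentumRate P Δt s s' x))
      - (∫ x in M.Ω, contract (grad w x)
          (P.rho (φMid s s' x) • outer (uMid s s' x) (uMid s s' x)))
      - (∫ x in M.Ω, divg w x * s'.p x)
      + (∫ x in M.Ω, contract (grad w x) (P.stress (uMid s s') (φMid s s') x))
      + 1 / P.Fr ^ 2 * (∫ x in M.Ω, dot (w x) (P.rho (φMid s s' x) • P.jvec))
      - (∫ x in M.Ω, dot (w x) (s'.v x • gradient (φMid s s') x))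
      - (∫ x in M.Ω, dot (w x)
          ((P.varrhoM (φMid s s' x) * (‖uMid s s' x‖ ^ 2 / 2 - 1 / P.Fr ^ 2 * P.y x)) •
            gradient (φMid s s') x))
      + (∑ K, ∫ x in M.elem K, contract (grad w x)
          (theta P M Δt s s' K x • grad (uMid s s') x))
      - (∑ K, ∫ x in M.elem K,
          τ K x * dot (w x) (gradient s'.v x) * levelSetResidual Δt s s' x) = 0
  continuity : ∀ q ∈ X.Q, ∫ x in M.Ω, q x * divg (uMid s s') x = 0
  levelSet : ∀ ψ ∈ X.S,
    (∫ x in M.Ω, ψ x *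
        ((s'.φ x - s.φ x) / Δt + dot (uMid s s' x) (gradient (φMid s s') x)))
      + (∑ K, ∫ x in M.elem K,
          τ K x * dot (uMid s s' x) (gradient ψ x) * levelSetResidual Δt s s' x) = 0
  auxiliary : ∀ ζ ∈ X.S,
    (∫ x in M.Ω, ζ x * (s'.v x + P.varrhoA (s.φ x) (s'.φ x) *
        (1 / 2 * dot (s'.u x) (s.u x) - 1 / P.Fr ^ 2 * P.y x)))
      - 1 / P.We * (∫ x in M.Ω,
          ζ x * P.varsigma (s.φ x) (s'.φ x) * gradNormAvg P s s' x)
      - 1 / P.We * (∫ x in M.Ω, dot (deltaAvg P s s' x • gradient ζ x)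
          ((1 / gradNormAvg P s s' x) • gradAvg s s' x)) = 0

/-! ### Energy and dissipation -/

/-- The kinetic energy `(½ ρ(φ) u, u)_Ω`. -/
def kineticEnergy {d : ℕ} (P : Params d) (M : Mesh d) (s : State d) : ℝ :=
  ∫ x in M.Ω, 1 / 2 * P.rho (s.φ x) * dot (s.u x) (s.u x)

/-- The gravitational energy `Fr⁻² (ρ(φ), y)_Ω`. -/
def gravityEnergy {d : ℕ} (P : Params d) (M : Mesh d) (s : State d) : ℝ :=
  1 / P.Fr ^ 2 * ∫ x in M.Ω, P.rho (s.φ x) * P.y x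

/-- The surface energy `We⁻¹ (1, δ_ε(φ) ‖∇φ‖_{ϵ,2})_Ω`. -/
def surfaceEnergy {d : ℕ} (P : Params d) (M : Mesh d) (s : State d) : ℝ :=
  1 / P.We * ∫ x in M.Ω, deltaEps P.ε (s.φ x) * regNorm P.ϵ (gradient s.φ x)

/-- The total discrete energy. -/
def energy {d : ℕ} (P : Params d) (M : Mesh d) (s : State d) : ℝ :=
  kineticEnergy P M s + gravityEnergy P M s + surfaceEnergy P M s

/-- The viscous dissipation `(∇u_{n+1/2}, 𝛕(u_{n+1/2}, φ_{n+1/2}))_Ω`. -/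
def viscousDissipation {d : ℕ} (P : Params d) (M : Mesh d) (s s' : State d) : ℝ :=
  ∫ x in M.Ω, contract (grad (uMid s s') x) (P.stress (uMid s s') (φMid s s') x)

/-- The numerical dissipation `∑_K (∇u_{n+1/2}, θ_K ∇u_{n+1/2})_{Ω_K}`. -/
def capturingDissipation {d : ℕ} (P : Params d) (M : Mesh d) (Δt : ℝ) (s s' : State d) : ℝ :=
  ∑ K, ∫ x in M.elem K, contract (grad (uMid s s') x)
    (theta P M Δt s s' K x • grad (uMid s s') x)

end

end LevelSetNS

/-! The density bounds hold because `Hp` is nondecreasing with values in [0, 1], so ρ(φ) is a convex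
combination of ρ₁ and ρ₂. The velocity u = u_{n+1/2} is solenoidal because its divergence agrees
a.e. with an admissible pressure: testing continuity with that pressure gives ‖∇·u‖² = 0.

The energy law comes from testing with w = u, q = p_{n+1}, ψ = v_{n+1} and ζ = ⟦φ⟧/Δt, and adding
momentum and level-set equations, minus the auxiliary one. The pressure term vanishes by continuity;
the stabilization sums cancel between momentum and level set, as do the terms v u·∇φ; the remaining
v⟦φ⟧/Δt is removed by the auxiliary equation.

Two facts turn the rest into energy differences. (a) Convection, gravity and the ϱ_m term combine to
(u, ∇g) with g = ρ(φ)(½|u|² − y/Fr²). This is zero since u is solenoidal and vanishes on ∂Ω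
(`integral_convection_cancel`, resting on the integration by parts `integral_dot_gradient_eq_zero`).
(b) The discrete chain rules are exact: ϱ_a⟦φ⟧ = ⟦ρ⟧ and ς⟦φ⟧ = ⟦δ⟧ (`varrhoA_mul_sub`,
`varsigma_mul_sub`), and `dot_sub_avg` handles the regularized norm of ∇φ. With the product rule for
averages and jumps they yield the jumps of gravitational and surface energy, while the ⟦ρ⟧ remainder
of the kinetic energy (`dot_momentumRate`) is absorbed by ϱ_a · ½u_{n+1}·u_n.

What is left is minus the two dissipations, whose integrands are pointwise nonnegative. -/

namespace LevelSetNS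

/-! ### The regularized Heaviside function and its derivative -/

/-- The derivative of `H^p` in closed form. -/
noncomputable def HpDeriv (z : ℝ) : ℝ := 5 / 4 * (1 - min |z| 1) ^ 3 * (1 + 3 * min |z| 1)

lemma continuous_HpDeriv : Continuous HpDeriv := by
  unfold HpDeriv; fun_prop

lemma HpDeriv_nonneg (z : ℝ) : 0 ≤ HpDeriv z := by
  have h1 : 0 ≤ min |z| 1 := by positivity
  have h2 : 0 ≤ 1 - min |z| 1 := by linarith [min_le_right |z| 1]
  unfold HpDeriv; positivity

/-- A crude bound, 5/4 · 1 · 4. Only its finiteness matters: it makes ρ Lipschitz. -/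
lemma HpDeriv_le (z : ℝ) : HpDeriv z ≤ 5 := by
  have h1 : 0 ≤ min |z| 1 := by positivity
  have h2 : 0 ≤ 1 - min |z| 1 := by linarith [min_le_right |z| 1]
  have h3 : (1 - min |z| 1) ^ 3 ≤ 1 := pow_le_one₀ h2 (by linarith)
  have h4 : 0 ≤ (1 - min |z| 1) ^ 3 := by positivity
  unfold HpDeriv
  nlinarith [min_le_right |z| 1]

/-- The polynomial `c₀ + c₁ x + ⋯ + c₅ x⁵`. -/
def quintic (c : Fin 6 → ℝ) (x : ℝ) : ℝ :=
  c 0 + c 1 * x + c 2 * x ^ 2 + c 3 * x ^ 3 + c 4 * x ^ 4 + c 5 * x ^ 5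

/-- The coefficients of the derivative of `quintic c`. -/
def quinticDeriv (c : Fin 6 → ℝ) : Fin 6 → ℝ := ![c 1, 2 * c 2, 3 * c 3, 4 * c 4, 5 * c 5, 0]

lemma hasDerivAt_quintic (c : Fin 6 → ℝ) (x : ℝ) :
    HasDerivAt (quintic c) (quintic (quinticDeriv c) x) x := by
  have h (n : ℕ) := hasDerivAt_pow n x
  have := (((((hasDerivAt_const x (c 0)).add ((hasDerivAt_id x).const_mul (c 1))).add
    ((h 2).const_mul (c 2))).add ((h 3).const_mul (c 3))).add ((h 4).const_mul (c 4))).add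
    ((h 5).const_mul (c 5))
  refine this.congr_deriv ?_
  simp [quintic, quinticDeriv]
  ring

lemma deriv_quintic (c : Fin 6 → ℝ) : deriv (quintic c) = quintic (quinticDeriv c) :=
  funext fun x => (hasDerivAt_quintic c x).deriv

lemma iteratedDeriv_quintic (c : Fin 6 → ℝ) (k : ℕ) :
    iteratedDeriv k (quintic c) = quintic (quinticDeriv^[k] c) := by
  induction k generalizing c with
  | zero => simp
  | succ k ih => rw [iteratedDeriv_succ', deriv_quintic, ih, Function.iterate_succ_apply]

/-- The coefficients of the four polynomial pieces of `H^p`. -/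
noncomputable def HpCoeff : Fin 4 → Fin 6 → ℝ :=
  ![0, ![1 / 2, 5 / 4, 0, -(5 / 2), -(5 / 2), -(3 / 4)],
    ![1 / 2, 5 / 4, 0, -(5 / 2), 5 / 2, -(3 / 4)], ![1, 0, 0, 0, 0, 0]]

/-- Neighbouring quintics agree at the breakpoints, so each formula extends to the closed piece. The
closed form is what allows one-sided derivatives to be glued. -/
lemma Hp_of_lt {z : ℝ} (h : z ≤ -1) : Hp z = quintic (HpCoeff 0) z := by
  rcases h.lt_or_eq with h | rfl
  · simp [Hp, h, HpCoeff, quintic]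
  · norm_num [Hp, HpCoeff, quintic]

lemma Hp_of_neg {z : ℝ} (h : -1 ≤ z) (h' : z ≤ 0) : Hp z = quintic (HpCoeff 1) z := by
  rcases h'.lt_or_eq with h' | rfl
  · simp [Hp, h.not_gt, h', HpCoeff, quintic]
    ring
  · norm_num [Hp, HpCoeff, quintic]

lemma Hp_of_pos {z : ℝ} (h : 0 ≤ z) (h' : z ≤ 1) : Hp z = quintic (HpCoeff 2) z := by
  have h0 : ¬ z < -1 := by linarith
  rcases h'.lt_or_eq with h' | rfl
  · simp [Hp, h0, h.not_gt, h', HpCoeff, quintic]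
    ring
  · simp [Hp, HpCoeff, quintic]
    norm_num

lemma Hp_of_gt {z : ℝ} (h : 1 ≤ z) : Hp z = quintic (HpCoeff 3) z := by
  have h0 : ¬ z < -1 := by linarith
  have h1 : ¬ z < 0 := by linarith
  simp [Hp, h0, h1, h.not_gt, HpCoeff, quintic]

lemma HpDeriv_of_lt {z : ℝ} (h : z ≤ -1) :
    HpDeriv z = quintic (quinticDeriv (HpCoeff 0)) z := by
  have : min |z| 1 = 1 := min_eq_right (by rw [abs_of_nonpos (by linarith)]; linarith)
  simp [HpDeriv, this, HpCoeff, quintic, quinticDeriv]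

lemma HpDeriv_of_neg {z : ℝ} (h : -1 ≤ z) (h' : z ≤ 0) :
    HpDeriv z = quintic (quinticDeriv (HpCoeff 1)) z := by
  have : min |z| 1 = -z := by
    rw [abs_of_nonpos h']
    exact min_eq_left (by linarith)
  simp [HpDeriv, this, HpCoeff, quintic, quinticDeriv]
  ring

lemma HpDeriv_of_pos {z : ℝ} (h : 0 ≤ z) (h' : z ≤ 1) :
    HpDeriv z = quintic (quinticDeriv (HpCoeff 2)) z := by
  have : min |z| 1 = z := by
    rw [abs_of_nonneg h]
    exact min_eq_left h'
  simp [HpDeriv, this, HpCoeff, quintic, quinticDeriv]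
  ring

lemma HpDeriv_of_gt {z : ℝ} (h : 1 ≤ z) :
    HpDeriv z = quintic (quinticDeriv (HpCoeff 3)) z := by
  have : min |z| 1 = 1 := min_eq_right (by rwa [abs_of_nonneg (by linarith)])
  simp [HpDeriv, this, HpCoeff, quintic, quinticDeriv]

lemma hasDerivWithinAt_Hp_of_eqOn {c : Fin 6 → ℝ} {s : Set ℝ} {z : ℝ} (hz : z ∈ s)
    (h : ∀ x ∈ s, Hp x = quintic c x) (h' : ∀ x ∈ s, HpDeriv x = quintic (quinticDeriv c) x) :
    HasDerivWithinAt Hp (HpDeriv z) s z := by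
  rw [h' z hz]
  exact (hasDerivAt_quintic c z).hasDerivWithinAt.congr h (h z hz)

/-- Inside a piece this is the derivative of a polynomial. At a breakpoint the derivatives within
the two adjacent closed pieces have the same value `HpDeriv z`, and the union of these pieces is a
neighbourhood. -/
lemma hasDerivAt_Hp (z : ℝ) : HasDerivAt Hp (HpDeriv z) z := by
  have glue {s : Set ℝ} (hs : s ∈ nhds z) (h : HasDerivWithinAt Hp (HpDeriv z) s z) :
      HasDerivAt Hp (HpDeriv z) z := h.hasDerivAt hs
  have d0 (hz : z ≤ -1) : HasDerivWithinAt Hp (HpDeriv z) (Set.Iic (-1)) z :=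
    hasDerivWithinAt_Hp_of_eqOn hz (fun _ h => Hp_of_lt h) fun _ h => HpDeriv_of_lt h
  have d1 (hz : -1 ≤ z) (hz' : z ≤ 0) : HasDerivWithinAt Hp (HpDeriv z) (Set.Icc (-1) 0) z :=
    hasDerivWithinAt_Hp_of_eqOn ⟨hz, hz'⟩ (fun _ h => Hp_of_neg h.1 h.2)
      fun _ h => HpDeriv_of_neg h.1 h.2
  have d2 (hz : 0 ≤ z) (hz' : z ≤ 1) : HasDerivWithinAt Hp (HpDeriv z) (Set.Icc 0 1) z :=
    hasDerivWithinAt_Hp_of_eqOn ⟨hz, hz'⟩ (fun _ h => Hp_of_pos h.1 h.2)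
      fun _ h => HpDeriv_of_pos h.1 h.2
  have d3 (hz : 1 ≤ z) : HasDerivWithinAt Hp (HpDeriv z) (Set.Ici 1) z :=
    hasDerivWithinAt_Hp_of_eqOn hz (fun _ h => Hp_of_gt h) fun _ h => HpDeriv_of_gt h
  rcases lt_trichotomy z (-1) with h | h | h
  · exact glue (Iic_mem_nhds h) (d0 h.le)
  · refine glue ?_ ((d0 h.le).union (d1 h.ge (by linarith)))
    rw [Set.Iic_union_Icc_eq_Iic (by norm_num)]
    exact Iic_mem_nhds (by linarith)
  rcases lt_trichotomy z 0 with h0 | h0 | h0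
  · exact glue (Icc_mem_nhds h h0) (d1 h.le h0.le)
  · refine glue ?_ ((d1 h.le h0.le).union (d2 h0.ge (by linarith)))
    rw [Set.Icc_union_Icc_eq_Icc (by norm_num) (by norm_num)]
    exact Icc_mem_nhds h (by linarith)
  rcases lt_trichotomy z 1 with h1 | h1 | h1
  · exact glue (Icc_mem_nhds h0 h1) (d2 h0.le h1.le)
  · refine glue ?_ ((d2 h0.le h1.le).union (d3 h1.ge))
    rw [Set.Icc_union_Ici_eq_Ici (by norm_num)]
    exact Ici_mem_nhds h0
  · exact glue (Ici_mem_nhds h1) (d3 h1.le)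

/-- Monotonicity yields the bounds 0 and 1 by comparison with a point of the outer, constant pieces.
-/
lemma monotone_Hp : Monotone Hp :=
  monotone_of_deriv_nonneg (fun z => (hasDerivAt_Hp z).differentiableAt) fun z => by
    rw [(hasDerivAt_Hp z).deriv]; exact HpDeriv_nonneg z

lemma Hp_nonneg (z : ℝ) : 0 ≤ Hp z := by
  calc (0 : ℝ) = Hp (min z (-2)) := by
        rw [Hp_of_lt ((min_le_right _ _).trans (by norm_num))]; simp [HpCoeff, quintic]
    _ ≤ Hp z := monotone_Hp (min_le_left _ _)

lemma Hp_le_one (z : ℝ) : Hp z ≤ 1 := by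
  calc Hp z ≤ Hp (max z 1) := monotone_Hp (le_max_left _ _)
    _ = 1 := by rw [Hp_of_gt (le_max_right _ _)]; simp [HpCoeff, quintic]

lemma Heps_nonneg (ε φ : ℝ) : 0 ≤ Heps ε φ := Hp_nonneg _

lemma Heps_le_one (ε φ : ℝ) : Heps ε φ ≤ 1 := Hp_le_one _

lemma hasDerivAt_Heps (ε φ : ℝ) : HasDerivAt (Heps ε) (HpDeriv (φ / ε) / ε) φ := by
  have := (hasDerivAt_Hp (φ / ε)).comp φ ((hasDerivAt_id φ).div_const ε)
  exact this.congr_deriv (by ring)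

lemma deltaEps_eq (ε φ : ℝ) : deltaEps ε φ = HpDeriv (φ / ε) / ε := (hasDerivAt_Heps ε φ).deriv

lemma continuous_deltaEps (ε : ℝ) : Continuous (deltaEps ε) := by
  rw [funext (deltaEps_eq ε)]
  have := continuous_HpDeriv
  fun_prop

lemma deltaEps_nonneg {ε : ℝ} (hε : 0 < ε) (φ : ℝ) : 0 ≤ deltaEps ε φ := by
  rw [deltaEps_eq]; exact div_nonneg (HpDeriv_nonneg _) hε.le

lemma deltaEps_le {ε : ℝ} (hε : 0 < ε) (φ : ℝ) : deltaEps ε φ ≤ 5 / ε := by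
  rw [deltaEps_eq]; gcongr; exact HpDeriv_le _

/-! ### Exact discrete chain rules -/

/-- Makes every piece order-convex: two values in one piece enclose no other piece. -/
lemma piece_monotone {ε : ℝ} (hε : 0 < ε) : Monotone (piece ε) := by
  intro a b hab
  have h : a / ε ≤ b / ε := by gcongr
  unfold piece
  split_ifs <;> first | decide | (exfalso; linarith)

lemma Hp_eq_quintic (ε φ : ℝ) : Hp (φ / ε) = quintic (HpCoeff (piece ε φ)) (φ / ε) := by
  unfold piece
  split_ifs with h0 h1 h2
  · exact Hp_of_lt h0.le
  · exact Hp_of_neg (not_lt.1 h0) h1.le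
  · exact Hp_of_pos (not_lt.1 h1) h2.le
  · exact Hp_of_gt (not_lt.1 h2)

lemma HpDeriv_eq_quintic (ε φ : ℝ) :
    HpDeriv (φ / ε) = quintic (quinticDeriv (HpCoeff (piece ε φ))) (φ / ε) := by
  unfold piece
  split_ifs with h0 h1 h2
  · exact HpDeriv_of_lt h0.le
  · exact HpDeriv_of_neg (not_lt.1 h0) h1.le
  · exact HpDeriv_of_pos (not_lt.1 h1) h2.le
  · exact HpDeriv_of_gt (not_lt.1 h2)

lemma Heps_eq_quintic_of_piece (ε : ℝ) (k : Fin 4) :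
    ∃ c : Fin 6 → ℝ, ∀ φ, piece ε φ = k →
      Heps ε φ = quintic c φ ∧ deltaEps ε φ = quintic (quinticDeriv c) φ := by
  -- The substitution z = φ/ε is absorbed into the coefficients.
  refine ⟨fun i => HpCoeff k i / ε ^ (i : ℕ), fun φ hφ => ⟨?_, ?_⟩⟩
  · rw [Heps, Hp_eq_quintic, hφ]
    simp [quintic]
    ring
  · rw [deltaEps_eq, HpDeriv_eq_quintic, hφ]
    simp [quintic, quinticDeriv]
    ring

/-- Taylor expansion about the midpoint terminates, as one piece of H_ε is a quintic. In the
difference of the endpoint values the even terms cancel and the odd ones double: 2(h/2)³/3! = h³/24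
and 2(h/2)⁵/5! = h⁵/1920 with h = b − a. For the quartic δ the expansion stops at order three. -/
lemma Heps_sub_of_piece_eq {ε : ℝ} (hε : 0 < ε) {a b : ℝ} (h : piece ε a = piece ε b) :
    Heps ε b - Heps ε a = (iteratedDeriv 1 (Heps ε) ((a + b) / 2)
      + 1 / 24 * iteratedDeriv 3 (Heps ε) ((a + b) / 2) * (b - a) ^ 2
      + 1 / 1920 * iteratedDeriv 5 (Heps ε) ((a + b) / 2) * (b - a) ^ 4) * (b - a) ∧
    deltaEps ε b - deltaEps ε a = (iteratedDeriv 1 (deltaEps ε) ((a + b) / 2)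
      + (b - a) ^ 2 / 24 * iteratedDeriv 3 (deltaEps ε) ((a + b) / 2)) * (b - a) := by
  -- If a = b, the midpoint may be a breakpoint, where higher derivatives need not exist; they are
  -- multiplied by b − a = 0. If a ≠ b, the midpoint is interior to an interval within a single
  -- piece.
  rcases eq_or_ne a b with rfl | hne
  · simp
  obtain ⟨c, hc⟩ := Heps_eq_quintic_of_piece ε (piece ε a)
  have hmem : ∀ x ∈ Set.Ioo (min a b) (max a b), piece ε x = piece ε a := by
    intro x hx
    have h1 := piece_monotone hε hx.1.le
    have h2 := piece_monotone hε hx.2.le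
    rw [(piece_monotone hε).map_min, ← h, min_self] at h1
    rw [(piece_monotone hε).map_max, ← h, max_self] at h2
    exact le_antisymm h2 h1
  have hm : Set.Ioo (min a b) (max a b) ∈ nhds ((a + b) / 2) := by
    apply Ioo_mem_nhds
    · rcases hne.lt_or_gt with h | h
      · rw [min_eq_left h.le]; linarith
      · rw [min_eq_right h.le]; linarith
    · rcases hne.lt_or_gt with h | h
      · rw [max_eq_right h.le]; linarith
      · rw [max_eq_left h.le]; linarith
  have e1 : Heps ε =ᶠ[nhds ((a + b) / 2)] quintic c := by
    filter_upwards [hm] with x hx using (hc x (hmem x hx)).1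
  have e2 : deltaEps ε =ᶠ[nhds ((a + b) / 2)] quintic (quinticDeriv c) := by
    filter_upwards [hm] with x hx using (hc x (hmem x hx)).2
  rw [(hc a rfl).1, (hc b h.symm).1, (hc a rfl).2, (hc b h.symm).2]
  simp only [e1.iteratedDeriv_eq, e2.iteratedDeriv_eq, iteratedDeriv_quintic,
    Function.iterate_succ, Function.iterate_zero, Function.comp_apply, id]
  simp [quintic, quinticDeriv]
  constructor <;> ring

/-! ### Jump identities and bounds for the material coefficients -/

namespace Params

variable {d : ℕ} (P : Params d)

lemma ne_of_piece_ne {ε a b : ℝ} (h : ¬ piece ε a = piece ε b) : b - a ≠ 0 := by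
  rintro h0
  rw [sub_eq_zero.1 h0] at h
  exact h rfl

lemma varrhoA_mul_sub (a b : ℝ) : P.varrhoA a b * (b - a) = P.rho b - P.rho a := by
  unfold varrhoA
  split_ifs with h
  · have := (Heps_sub_of_piece_eq P.ε_pos h).1
    unfold varrhoT rho
    rw [mul_assoc, ← this]
    ring
  · exact div_mul_cancel₀ _ (ne_of_piece_ne h)

lemma varsigma_mul_sub (a b : ℝ) :
    P.varsigma a b * (b - a) = deltaEps P.ε b - deltaEps P.ε a := by
  unfold varsigma
  split_ifs with h
  · exact (Heps_sub_of_piece_eq P.ε_pos h).2.symm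
  · exact div_mul_cancel₀ _ (ne_of_piece_ne h)

lemma rho_mem (φ : ℝ) : P.ρ₂ ≤ P.rho φ ∧ P.rho φ ≤ P.ρ₁ := by
  have h0 := Heps_nonneg P.ε φ
  have h1 := Heps_le_one P.ε φ
  have h2 := P.ρ₂_le_ρ₁
  unfold rho
  constructor <;> nlinarith

lemma mu_nonneg (φ : ℝ) : 0 ≤ P.mu φ :=
  add_nonneg (mul_nonneg P.μ₁_pos.le (Heps_nonneg _ _))
    (mul_nonneg P.μ₂_pos.le (sub_nonneg.2 (Heps_le_one _ _)))

lemma hasDerivAt_rho (φ : ℝ) : HasDerivAt P.rho (P.varrhoM φ) φ := by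
  have h := hasDerivAt_Heps P.ε φ
  have := (h.const_mul P.ρ₁).add ((h.const_sub 1).const_mul P.ρ₂)
  refine this.congr_deriv ?_
  rw [varrhoM, h.deriv]
  ring

lemma abs_varrhoM_le (φ : ℝ) : |P.varrhoM φ| ≤ (P.ρ₁ - P.ρ₂) * (5 / P.ε) := by
  have h := P.ρ₂_le_ρ₁
  have h1 := deltaEps_nonneg P.ε_pos φ
  have h2 := deltaEps_le P.ε_pos φ
  rw [deltaEps] at h1 h2
  rw [varrhoM, abs_of_nonneg (mul_nonneg (by linarith) h1)]
  exact mul_le_mul_of_nonneg_left h2 (by linarith)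

lemma continuous_varrhoM : Continuous P.varrhoM :=
  (continuous_deltaEps P.ε).const_mul (P.ρ₁ - P.ρ₂)

lemma lipschitzWith_rho : ∃ L : ℝ≥0, LipschitzWith L P.rho :=
  ⟨Real.toNNReal ((P.ρ₁ - P.ρ₂) * (5 / P.ε)),
    lipschitzWith_of_nnnorm_deriv_le (fun φ => (P.hasDerivAt_rho φ).differentiableAt) fun φ => by
      rw [(P.hasDerivAt_rho φ).deriv, ← NNReal.coe_le_coe]
      exact (P.abs_varrhoM_le φ).trans (Real.le_coe_toNNReal _)⟩

end Params

/-! ### The physical domain -/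

namespace Mesh

variable {d : ℕ} (M : Mesh d)

lemma isOpen_Ω : IsOpen M.Ω := M.F.open_target

lemma measurableSet_Ω : MeasurableSet M.Ω := M.isOpen_Ω.measurableSet

lemma isOpen_openBox (a b : E d) : IsOpen (openBox a b) := by
  simp only [openBox, Set.ofPred_forall]
  exact isOpen_iInter_of_finite fun i => isOpen_Ioo.preimage (by fun_prop)

lemma openBox_subset_source (K : Fin M.numElem) : openBox (M.lo K) (M.hi K) ⊆ M.F.source :=
  M.source_eq ▸ M.subset K

lemma isOpen_elem (K : Fin M.numElem) : IsOpen (M.elem K) :=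
  M.F.isOpen_image_of_subset_source (isOpen_openBox _ _) (M.openBox_subset_source K)

lemma elem_subset_Ω (K : Fin M.numElem) : M.elem K ⊆ M.Ω := by
  rintro _ ⟨ξ, hξ, rfl⟩
  exact M.F.map_source (M.openBox_subset_source K hξ)

lemma convex_refCube : Convex ℝ (refCube d) := by
  intro x hx y hy a b ha hb hab i
  exact convex_Ioo (-1 : ℝ) 1 (hx i) (hy i) ha hb hab

lemma isBounded_refCube : Bornology.IsBounded (refCube d) := by
  refine isBounded_iff_forall_norm_le.2 ⟨√(∑ _ : Fin d, (1 : ℝ)), fun ξ hξ => ?_⟩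
  rw [EuclideanSpace.norm_eq]
  refine Real.sqrt_le_sqrt (Finset.sum_le_sum fun i _ => ?_)
  have h : ‖ξ i‖ < 1 := abs_lt.2 (hξ i)
  exact pow_le_one₀ (norm_nonneg _) h.le

/-- On the convex cube a bounded Jacobian makes F Lipschitz, so the image of the bounded cube is
bounded. Hence Ω has finite measure and bounded measurable functions are integrable. -/
lemma isBounded_Ω : Bornology.IsBounded M.Ω := by
  obtain ⟨c, hc⟩ := M.bounded_jacobian
  have hL : LipschitzOnWith (Real.toNNReal c) M.F M.F.source := by
    refine Convex.lipschitzOnWith_of_nnnorm_fderiv_le (𝕜 := ℝ) (fun ξ hξ => ?_) (fun ξ hξ => ?_)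
      (M.source_eq ▸ convex_refCube)
    · exact (M.contDiffOn_F.differentiableOn (by norm_num)).differentiableAt
        (M.F.open_source.mem_nhds hξ)
    · rw [← NNReal.coe_le_coe]
      exact (hc ξ hξ).trans (Real.le_coe_toNNReal _)
  have hb : Bornology.IsBounded M.F.source := M.source_eq ▸ isBounded_refCube
  obtain ⟨D, hD⟩ := Metric.isBounded_iff.1 hb
  refine Metric.isBounded_iff.2 ⟨Real.toNNReal c * D, ?_⟩
  rw [Ω, ← M.F.image_source_eq_target]
  rintro _ ⟨ξ, hξ, rfl⟩ _ ⟨η, hη, rfl⟩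
  exact (hL.dist_le_mul ξ hξ η hη).trans (by gcongr; exact hD hξ hη)

lemma volume_hyperplane (i : Fin d) (c : ℝ) : volume {ξ : E d | ξ i = c} = 0 := by
  have hs : MeasurableSet {f : Fin d → ℝ | f i = c} :=
    measurableSet_eq_fun (measurable_pi_apply i) measurable_const
  have h := (PiLp.volume_preserving_ofLp (Fin d)).measure_preimage hs.nullMeasurableSet
  rw [volume_pi, Measure.pi_hyperplane] at h
  exact h

/-- Points of the cube missed by the open boxes lie on the finitely many hyperplanes carrying box
faces, and the differentiable map F sends null sets to null sets. -/
lemma volume_diff_iUnion_elem : volume (M.Ω \ ⋃ K, M.elem K) = 0 := by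
  set Z : Set (E d) := M.F.source ∩ ⋃ K, ⋃ i, {ξ | ξ i = M.lo K i} ∪ {ξ | ξ i = M.hi K i}
  have hZ : volume Z = 0 := by
    refine measure_mono_null Set.inter_subset_right ?_
    simp only [measure_iUnion_null_iff, measure_union_null_iff]
    exact fun K i => ⟨volume_hyperplane i _, volume_hyperplane i _⟩
  have himg : volume (M.F '' Z) = 0 :=
    addHaar_image_eq_zero_of_differentiableOn_of_addHaar_eq_zero volume
      ((M.contDiffOn_F.differentiableOn (by norm_num)).mono Set.inter_subset_left) hZ
  refine measure_mono_null ?_ himg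
  rintro x ⟨hx, hx'⟩
  have hξ : M.F.symm x ∈ M.F.source := M.F.map_target hx
  refine ⟨M.F.symm x, ⟨hξ, ?_⟩, M.F.right_inv hx⟩
  by_contra hnot
  simp only [Set.mem_iUnion, Set.mem_union, Set.mem_ofPred_eq, not_exists, not_or] at hnot
  obtain ⟨K, hK⟩ := M.cover (M.F.symm x) (M.source_eq ▸ hξ)
  refine hx' (Set.mem_iUnion.2 ⟨K, M.F.symm x, fun i => ⟨?_, ?_⟩, M.F.right_inv hx⟩)
  · exact lt_of_le_of_ne (hK i).1 (Ne.symm (hnot K i).1)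
  · exact lt_of_le_of_ne (hK i).2 (hnot K i).2

lemma ae_mem_iUnion_elem : ∀ᵐ x ∂volume.restrict M.Ω, x ∈ ⋃ K, M.elem K := by
  rw [ae_restrict_iff' M.measurableSet_Ω, ae_iff]
  refine measure_mono_null ?_ M.volume_diff_iUnion_elem
  intro x hx
  simpa [Classical.not_imp] using hx

instance : IsFiniteMeasure (volume.restrict M.Ω) :=
  ⟨by rw [Measure.restrict_apply_univ]; exact M.isBounded_Ω.measure_lt_top⟩

end Mesh

/-! ### Lipschitz functions -/

/-- The function is Lipschitz on `s`, with some constant. -/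
def LipOn {α β : Type*} [PseudoEMetricSpace α] [PseudoEMetricSpace β] (f : α → β) (s : Set α) :
    Prop := ∃ L : ℝ≥0, LipschitzOnWith L f s

section LipOn

variable {α : Type*} [PseudoMetricSpace α] {s : Set α}

lemma LipOn.add {G : Type*} [SeminormedAddCommGroup G] {f g : α → G} (hf : LipOn f s)
    (hg : LipOn g s) : LipOn (fun x => f x + g x) s :=
  ⟨_, hf.choose_spec.add hg.choose_spec⟩

lemma LipOn.comp {β γ : Type*} [PseudoEMetricSpace β] [PseudoEMetricSpace γ] {g : β → γ}
    {f : α → β} (hg : ∃ L : ℝ≥0, LipschitzWith L g) (hf : LipOn f s) :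
    LipOn (fun x => g (f x)) s :=
  ⟨_, hg.choose_spec.comp_lipschitzOnWith hf.choose_spec⟩

lemma LipOn.exists_norm_le {G : Type*} [SeminormedAddCommGroup G] {f : α → G}
    (hs : Bornology.IsBounded s) (hf : LipOn f s) : ∃ C, 0 ≤ C ∧ ∀ x ∈ s, ‖f x‖ ≤ C := by
  obtain ⟨L, hL⟩ := hf
  obtain ⟨D, hD⟩ := Metric.isBounded_iff.1 hs
  rcases s.eq_empty_or_nonempty with rfl | ⟨x₀, hx₀⟩
  · exact ⟨0, le_rfl, by simp⟩
  have hD0 : 0 ≤ D := dist_nonneg.trans (hD hx₀ hx₀)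
  refine ⟨L * D + ‖f x₀‖, by positivity, fun x hx => ?_⟩
  calc ‖f x‖ ≤ ‖f x - f x₀‖ + ‖f x₀‖ := by simpa using norm_add_le (f x - f x₀) (f x₀)
    _ ≤ L * D + ‖f x₀‖ := by
      gcongr
      rw [← dist_eq_norm]
      exact (hL.dist_le_mul x hx x₀ hx₀).trans (by gcongr; exact hD hx hx₀)

lemma LipOn.mul {f g : α → ℝ} (hs : Bornology.IsBounded s) (hf : LipOn f s) (hg : LipOn g s) :
    LipOn (fun x => f x * g x) s := by
  obtain ⟨A, hA0, hA⟩ := hf.exists_norm_le hs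
  obtain ⟨B, hB0, hB⟩ := hg.exists_norm_le hs
  obtain ⟨K, hK⟩ := hf
  obtain ⟨L, hL⟩ := hg
  refine ⟨Real.toNNReal (A * L + B * K), LipschitzOnWith.of_dist_le_mul fun x hx y hy => ?_⟩
  rw [Real.coe_toNNReal _ (by positivity), Real.dist_eq]
  have e : f x * g x - f y * g y = f x * (g x - g y) + g y * (f x - f y) := by ring
  have h1 := hL.dist_le_mul x hx y hy
  have h2 := hK.dist_le_mul x hx y hy
  rw [Real.dist_eq] at h1 h2
  calc |f x * g x - f y * g y| ≤ |f x| * |g x - g y| + |g y| * |f x - f y| := by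
        rw [e, ← abs_mul, ← abs_mul]; exact abs_add_le _ _
    _ ≤ A * (L * dist x y) + B * (K * dist x y) := by
        gcongr
        · exact hA x hx
        · exact hB y hy
    _ = (A * L + B * K) * dist x y := by ring

lemma LipOn.coord {d : ℕ} {u : α → E d} (hu : LipOn u s) (i : Fin d) :
    LipOn (fun x => u x i) s :=
  LipOn.comp (g := fun v : E d => v i) ⟨_, (EuclideanSpace.proj (𝕜 := ℝ) i).lipschitz⟩ hu

lemma dot_eq_sum {d : ℕ} (a b : E d) : dot a b = ∑ i, a i * b i := by
  simp [dot, PiLp.inner_apply, mul_comm]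

lemma LipOn.sum {ι : Type*} (t : Finset ι) {f : ι → α → ℝ} (hf : ∀ i, LipOn (f i) s) :
    LipOn (fun x => ∑ i ∈ t, f i x) s := by
  classical
  induction t using Finset.induction_on with
  | empty => exact ⟨0, by simpa only [Finset.sum_empty] using LipschitzWith.const (0 : ℝ) |>.lipschitzOnWith⟩
  | insert i t hi ih =>
    simp only [Finset.sum_insert hi]
    exact (hf i).add ih

lemma LipOn.dot {d : ℕ} {u w : α → E d} (hs : Bornology.IsBounded s) (hu : LipOn u s)
    (hw : LipOn w s) : LipOn (fun x => dot (u x) (w x)) s := by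
  simp only [dot_eq_sum]
  exact LipOn.sum _ fun i => (hu.coord i).mul hs (hw.coord i)

end LipOn

/-! ### Bounded functions on the domain -/

section Bounded

variable {d : ℕ} (M : Mesh d)

/-- Essentially bounded, a.e. strongly measurable functions on `Ω`. -/
abbrev Mesh.Bdd {G : Type*} [NormedAddCommGroup G] (f : E d → G) : Prop :=
  MemLp f ⊤ (volume.restrict M.Ω)

variable {M}

lemma Mesh.Bdd.integrable {f : E d → ℝ} (hf : M.Bdd f) : Integrable f (volume.restrict M.Ω) :=
  MemLp.integrable le_top hf

lemma Mesh.Bdd.mul {f g : E d → ℝ} (hf : M.Bdd f) (hg : M.Bdd g) :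
    M.Bdd fun x => f x * g x :=
  MemLp.mul (r := ⊤) hg hf

lemma Mesh.Bdd.const_mul {f : E d → ℝ} (hf : M.Bdd f) (c : ℝ) : M.Bdd fun x => c * f x :=
  MemLp.const_mul hf c

lemma Mesh.Bdd.add {f g : E d → ℝ} (hf : M.Bdd f) (hg : M.Bdd g) : M.Bdd fun x => f x + g x :=
  MemLp.add hf hg

lemma Mesh.Bdd.sub {f g : E d → ℝ} (hf : M.Bdd f) (hg : M.Bdd g) : M.Bdd fun x => f x - g x :=
  MemLp.sub hf hg

lemma Mesh.Bdd.coord {f : E d → E d} (hf : M.Bdd f) (i : Fin d) : M.Bdd fun x => f x i :=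
  (EuclideanSpace.proj (𝕜 := ℝ) i).comp_memLp' hf

lemma Mesh.Bdd.dot {f g : E d → E d} (hf : M.Bdd f) (hg : M.Bdd g) :
    M.Bdd fun x => dot (f x) (g x) := by
  simp only [dot_eq_sum]
  exact memLp_finsetSum _ fun i _ => (hf.coord i).mul (hg.coord i)

lemma Mesh.bdd_of_lipOn {G : Type*} [NormedAddCommGroup G] [SecondCountableTopology G]
    {f : E d → G} (hf : LipOn f (closure M.Ω)) : M.Bdd f := by
  obtain ⟨C, -, hC⟩ := hf.exists_norm_le M.isBounded_Ω.closure
  obtain ⟨L, hL⟩ := hf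
  refine memLp_top_of_bound
    ((hL.continuousOn.mono subset_closure).aestronglyMeasurable M.measurableSet_Ω) C ?_
  filter_upwards [ae_restrict_mem M.measurableSet_Ω] with x hx using hC x (subset_closure hx)

/-- On the open set Ω the Lipschitz constant bounds `fderiv` everywhere, also where the derivative
fails to exist and `fderiv` is 0. -/
lemma Mesh.bdd_fderiv {G : Type*} [NormedAddCommGroup G] [NormedSpace ℝ G]
    [FiniteDimensional ℝ G] {f : E d → G} (hf : LipOn f (closure M.Ω)) :
    M.Bdd (fderiv ℝ f) := by
  obtain ⟨L, hL⟩ := hf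
  have := FiniteDimensional.complete ℝ G
  refine memLp_top_of_bound (measurable_fderiv ℝ f).aestronglyMeasurable L ?_
  filter_upwards [ae_restrict_mem M.measurableSet_Ω] with x hx
  exact norm_fderiv_le_of_lipschitzOn ℝ (M.isOpen_Ω.mem_nhds hx) (hL.mono subset_closure)

lemma Mesh.bdd_gradient {f : E d → ℝ} (hf : LipOn f (closure M.Ω)) : M.Bdd (gradient f) :=
  MemLp.of_le (Mesh.bdd_fderiv hf)
    ((InnerProductSpace.toDual ℝ (E d)).symm.continuous.comp_aestronglyMeasurable
      (Mesh.bdd_fderiv hf).aestronglyMeasurable)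
    (Filter.Eventually.of_forall fun x =>
      ((InnerProductSpace.toDual ℝ (E d)).symm.norm_map (fderiv ℝ f x)).le)

lemma Mesh.bdd_grad {u : E d → E d} (hu : LipOn u (closure M.Ω)) (i j : Fin d) :
    M.Bdd fun x => grad u x i j :=
  ((EuclideanSpace.proj (𝕜 := ℝ) i).comp
    (ContinuousLinearMap.apply ℝ (E d) (EuclideanSpace.single j (1 : ℝ)))).comp_memLp'
      (Mesh.bdd_fderiv hu)

lemma Mesh.bdd_comp {g : ℝ → ℝ} (hg : Continuous g) {f : E d → ℝ}
    (hf : LipOn f (closure M.Ω)) : M.Bdd fun x => g (f x) := by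
  obtain ⟨C, hC0, hC⟩ := hf.exists_norm_le M.isBounded_Ω.closure
  obtain ⟨L, hL⟩ := hf
  obtain ⟨B, hB⟩ := (isCompact_Icc (a := -C) (b := C)).exists_bound_of_continuousOn hg.continuousOn
  refine memLp_top_of_bound ((hg.comp_continuousOn
    (hL.continuousOn.mono subset_closure)).aestronglyMeasurable M.measurableSet_Ω) B ?_
  filter_upwards [ae_restrict_mem M.measurableSet_Ω] with x hx
  exact hB _ (abs_le.1 (hC x (subset_closure hx)))

lemma Mesh.ae_differentiableAt {G : Type*} [NormedAddCommGroup G] [NormedSpace ℝ G]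
    [FiniteDimensional ℝ G] {f : E d → G} (hf : LipOn f (closure M.Ω)) :
    ∀ᵐ x ∂volume.restrict M.Ω, DifferentiableAt ℝ f x := by
  obtain ⟨L, hL⟩ := hf
  filter_upwards [(hL.mono subset_closure).ae_differentiableWithinAt (μ := volume)
    M.measurableSet_Ω, ae_restrict_mem M.measurableSet_Ω] with x hx hxΩ
  exact hx.differentiableAt (M.isOpen_Ω.mem_nhds hxΩ)

end Bounded

/-! ### Integration by parts for Lipschitz fields vanishing on the boundary -/

/-- Extension by zero of a Lipschitz function that vanishes on the boundary. -/
lemma lipschitzWith_indicator {α G : Type*} [NormedAddCommGroup α] [NormedSpace ℝ α]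
    [FiniteDimensional ℝ α] [NormedAddCommGroup G] {s : Set α} {u : α → G} {L : ℝ≥0}
    (hu : LipschitzOnWith L u (closure s)) (h0 : ∀ x ∈ frontier s, u x = 0) :
    LipschitzWith L (s.indicator u) := by
  -- Compare x with a nearest point z of the complement: z lies on the frontier, so u z = 0, and z
  -- is no farther from x than y is.
  have key : ∀ x ∈ s, ∀ y ∉ s, ‖u x‖ ≤ L * dist x y := by
    intro x hx y hy
    obtain ⟨z, hz, hxz⟩ := exists_mem_frontier_infDist_compl_eq_dist hx
      (fun h => hy (h ▸ Set.mem_univ y))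
    have h1 := hu.dist_le_mul x (subset_closure hx) z (frontier_subset_closure hz)
    rw [h0 z hz, dist_zero_right] at h1
    refine h1.trans ?_
    gcongr
    rw [← hxz]
    exact Metric.infDist_le_dist_of_mem hy
  refine LipschitzWith.of_dist_le_mul fun x y => ?_
  by_cases hx : x ∈ s <;> by_cases hy : y ∈ s
  · simpa [hx, hy] using hu.dist_le_mul x (subset_closure hx) y (subset_closure hy)
  · simpa [hx, hy] using key x hx y hy
  · simpa [hx, hy, dist_comm x y] using key y hy x hx
  · simp [hx, hy]
    positivity

/-- The derivative of a Lipschitz function vanishes almost everywhere on its zero set. -/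
lemma ae_fderiv_eq_zero_of_eq_zero {α : Type*} [NormedAddCommGroup α] [NormedSpace ℝ α]
    [FiniteDimensional ℝ α] [MeasurableSpace α] [BorelSpace α] (μ : Measure α)
    [μ.IsAddHaarMeasure] {f : α → α} {L : ℝ≥0} (hf : LipschitzWith L f) :
    ∀ᵐ x ∂μ, f x = 0 → fderiv ℝ f x = 0 := by
  set s : Set α := {x | f x = 0} ∩ {x | DifferentiableAt ℝ f x}
  have hs : MeasurableSet s :=
    (measurableSet_eq_fun hf.continuous.measurable measurable_const).inter
      (measurableSet_of_differentiableAt ℝ f)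
  -- On its zero set f is approximated by the linear map 0 with error constant 0, which forces the
  -- derivative to be within 0 of that map a.e. there.
  have happ : ApproximatesLinearOn f (0 : α →L[ℝ] α) s 0 := by
    rw [ApproximatesLinearOn.eq_1]
    intro x hx y hy
    have hx' : f x = 0 := hx.1
    have hy' : f y = 0 := hy.1
    simp [hx', hy']
  have h := happ.norm_fderiv_sub_le μ hs (fderiv ℝ f)
    fun x hx => (DifferentiableAt.hasFDerivAt hx.2).hasFDerivWithinAt
  rw [ae_restrict_iff' hs] at h
  filter_upwards [h, hf.ae_differentiableAt (μ := μ)] with x hx hd h0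
  simpa using hx ⟨h0, hd⟩

lemma fderiv_single_eq_gradient {d : ℕ} (g : E d → ℝ) (x : E d) (i : Fin d) :
    fderiv ℝ g x (EuclideanSpace.single i 1) = gradient g x i := by
  have : inner ℝ (gradient g x) (EuclideanSpace.single i (1 : ℝ)) =
      fderiv ℝ g x (EuclideanSpace.single i 1) := by
    rw [gradient, InnerProductSpace.toDual_symm_apply]
  rw [← this, EuclideanSpace.inner_single_right]
  simp

lemma dot_gradient {d : ℕ} (g : E d → ℝ) (x w : E d) :
    dot w (gradient g x) = fderiv ℝ g x w := by
  rw [dot, real_inner_comm, gradient, InnerProductSpace.toDual_symm_apply]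

lemma grad_congr {d : ℕ} {u w : E d → E d} {x : E d} (h : u =ᶠ[nhds x] w) :
    grad u x = grad w x := by
  simp only [grad, h.fderiv_eq]

lemma lineDeriv_coord {d : ℕ} {u : E d → E d} {x : E d} (h : DifferentiableAt ℝ u x)
    (i : Fin d) (v : E d) : lineDeriv ℝ (fun z => u z i) x v = fderiv ℝ u x v i := by
  have h1 : HasFDerivAt (fun z => u z i)
      ((EuclideanSpace.proj (𝕜 := ℝ) i).comp (fderiv ℝ u x)) x :=
    (EuclideanSpace.proj (𝕜 := ℝ) i).hasFDerivAt.comp x h.hasFDerivAt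
  rw [h1.differentiableAt.lineDeriv_eq_fderiv, h1.fderiv]
  rfl

/-- If `u` is Lipschitz, vanishes on `∂Ω` and is divergence-free, then `(u, ∇g)_Ω = 0`. -/
theorem integral_dot_gradient_eq_zero {d : ℕ} (M : Mesh d) {u : E d → E d} {g : E d → ℝ}
    (hu : LipOn u (closure M.Ω)) (h0 : ∀ x ∈ frontier M.Ω, u x = 0)
    (hdiv : ∀ᵐ x ∂volume.restrict M.Ω, divg u x = 0) (hg : LipOn g (closure M.Ω)) :
    ∫ x in M.Ω, dot (u x) (gradient g x) = 0 := by
  obtain ⟨L, hL⟩ := hu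
  obtain ⟨L', hL'⟩ := hg
  obtain ⟨G, hG, hgG⟩ := hL'.extend_real
  -- Both factors are extended to the whole space, u by zero and g as a Lipschitz function, so that
  -- no regularity of ∂Ω is needed for integration by parts.
  set U := M.Ω.indicator u with hU
  have hUL : LipschitzWith L U := lipschitzWith_indicator hL h0
  have hcpt : IsCompact (closure M.Ω) := M.isBounded_Ω.isCompact_closure
  have hUi (i : Fin d) : LipschitzWith (1 * L) fun x => U x i := by
    refine LipschitzWith.comp (g := U) (f := fun v : E d => v i) ?_ hUL
    exact LipschitzWith.of_dist_le_mul fun v w => by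
      simpa [dist_eq_norm] using PiLp.norm_apply_le (v - w) i
  have hsupp (i : Fin d) : HasCompactSupport fun x => U x i := by
    refine HasCompactSupport.of_support_subset_isCompact hcpt fun x hx => subset_closure ?_
    by_contra h
    exact hx (by simp [hU, h])
  have hUdiff := hUL.ae_differentiableAt (μ := (volume : Measure (E d)))
  -- The frontier is not known to be null, so points outside Ω are treated through the a.e.
  -- vanishing of the derivative on the zero set of U.
  have hdivU : ∀ᵐ x, divg U x = 0 := by
    rw [ae_restrict_iff' M.measurableSet_Ω] at hdiv
    filter_upwards [hdiv, ae_fderiv_eq_zero_of_eq_zero volume hUL] with x hx hz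
    by_cases hxΩ : x ∈ M.Ω
    · rw [divg, grad_congr (w := u), ← divg, hx hxΩ]
      filter_upwards [M.isOpen_Ω.mem_nhds hxΩ] with z hz using by simp [hU, hz]
    · simp [divg, grad, hz (by simp [hU, hxΩ]), Matrix.trace]
  have hint1 (i : Fin d) : Integrable
      fun x => lineDeriv ℝ G x (EuclideanSpace.single i 1) * U x i :=
    Integrable.bdd_mul ((hUi i).continuous.integrable_of_hasCompactSupport (hsupp i))
      (hG.memLp_lineDeriv _).aestronglyMeasurable
      (Filter.Eventually.of_forall fun x => norm_lineDeriv_le_of_lipschitz ℝ hG)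
  have hint2 (i : Fin d) : Integrable
      -- G may be non-integrable on the whole space, but the derivative of U vanishes off the
      -- compact closure of Ω, so G can be cut off there.
      fun x => lineDeriv ℝ (fun z => U z i) x (-EuclideanSpace.single i 1) * G x := by
    have hGi : Integrable ((closure M.Ω).indicator G) :=
      (hG.continuous.continuousOn.integrableOn_compact hcpt).integrable_indicator
        isClosed_closure.measurableSet
    refine (hGi.bdd_mul ((hUi i).memLp_lineDeriv (-EuclideanSpace.single i 1)).aestronglyMeasurable
      (Filter.Eventually.of_forall fun x => norm_lineDeriv_le_of_lipschitz ℝ (hUi i))).congr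
      (Filter.Eventually.of_forall fun x => ?_)
    by_cases hx : x ∈ closure M.Ω
    · simp [hx]
    · have : (fun z => U z i) =ᶠ[nhds x] fun _ => 0 := by
        filter_upwards [isClosed_closure.isOpen_compl.mem_nhds hx] with z hz
        have hz' : z ∉ M.Ω := fun h => hz (subset_closure h)
        simp [hU, hz']
      have h0 : lineDeriv ℝ (fun z => U z i) x (-EuclideanSpace.single i 1) = 0 := by
        rw [this.lineDeriv_eq]; simp [lineDeriv]
      simp [h0]
  have hibp : ∫ x, ∑ i, lineDeriv ℝ G x (EuclideanSpace.single i 1) * U x i = 0 := by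
    rw [integral_finsetSum _ fun i _ => hint1 i]
    simp only [hG.integral_lineDeriv_mul_eq (hUi _) (hsupp _)]
    rw [← integral_finsetSum _ fun i _ => hint2 i]
    refine integral_eq_zero_of_ae ?_
    filter_upwards [hdivU, hUdiff] with x hx hd
    simp only [lineDeriv_coord hd, Pi.zero_apply, map_neg, PiLp.neg_apply, ← Finset.sum_mul,
      Finset.sum_neg_distrib]
    simp only [divg, Matrix.trace, Matrix.diag_apply, grad, Matrix.of_apply] at hx
    rw [hx]
    simp
  rw [← integral_indicator M.measurableSet_Ω, ← hibp]
  refine integral_congr_ae ?_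
  filter_upwards [hG.ae_differentiableAt (μ := (volume : Measure (E d)))] with x hd
  by_cases hx : x ∈ M.Ω
  · have hgG' : g =ᶠ[nhds x] G := by
      filter_upwards [M.isOpen_Ω.mem_nhds hx] with z hz using hgG (subset_closure hz)
    have e : gradient g x = gradient G x := by rw [gradient, gradient, hgG'.fderiv_eq]
    simp only [Set.indicator_of_mem hx, e, dot_eq_sum, hd.lineDeriv_eq_fderiv,
      fderiv_single_eq_gradient, hU, mul_comm]
  · simp [hx, hU]

variable {d : ℕ} {P : Params d} {M : Mesh d} {X : DivConformingSpaces M} {Δt : ℝ}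
  {τ : Fin M.numElem → E d → ℝ} {s s' : State d}

/-! ### The intermediate velocity is divergence-free -/

lemma divg_eq_sum (u : E d → E d) (x : E d) :
    divg u x = ∑ i, fderiv ℝ u x (EuclideanSpace.single i 1) i := rfl

lemma continuousAt_divg {u : E d → E d} {x : E d} (hu : ContDiffAt ℝ 1 u x) :
    ContinuousAt (divg u) x := by
  have h : ContinuousAt (fderiv ℝ u) x :=
    (hu.fderiv_right (m := 0) (by norm_num)).continuousAt
  simp only [funext (divg_eq_sum u)]
  refine tendsto_finsetSum _ fun i _ => ?_
  exact ((EuclideanSpace.proj (𝕜 := ℝ) i).comp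
    (ContinuousLinearMap.apply ℝ (E d) (EuclideanSpace.single i (1 : ℝ)))).continuous.continuousAt.comp
    h

lemma Mesh.bdd_divg {u : E d → E d} (hu : LipOn u (closure M.Ω)) : M.Bdd (divg u) :=
  memLp_finsetSum Finset.univ fun i _ => M.bdd_grad hu i i

lemma State.Mem.uMid_mem (hs : s.Mem X) (hs' : s'.Mem X) : uMid s s' ∈ X.V :=
  X.V.smul_mem (1 / 2 : ℝ) (X.V.add_mem hs.1 hs'.1)

lemma State.Mem.φMid_mem (hs : s.Mem X) (hs' : s'.Mem X) : φMid s s' ∈ X.S :=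
  X.S.smul_mem (1 / 2 : ℝ) (X.S.add_mem hs.2.2.1 hs'.2.2.1)

/-- Divergence-conformity makes ∇·u an admissible test function up to the null mesh skeleton, so its
L² norm vanishes. -/
lemma DivConformingSpaces.ae_divg_eq_zero {u : E d → E d} (hu : u ∈ X.V)
    (h : ∀ q ∈ X.Q, ∫ x in M.Ω, q x * divg u x = 0) :
    ∀ᵐ x ∂volume.restrict M.Ω, divg u x = 0 := by
  obtain ⟨q, hq, hqu⟩ := X.div_V u hu
  have hint := M.bdd_divg (X.lipschitz_V u hu)
  have hsq : ∫ x in M.Ω, divg u x * divg u x = 0 := by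
    rw [← h q hq]
    refine integral_congr_ae ?_
    filter_upwards [M.ae_mem_iUnion_elem] with x hx
    obtain ⟨K, hK⟩ := Set.mem_iUnion.1 hx
    simp only [hqu K x hK]
  rw [integral_eq_zero_iff_of_nonneg (fun x => mul_self_nonneg _) (hint.mul hint).integrable] at hsq
  filter_upwards [hsq] with x hx using mul_self_eq_zero.1 hx

/-- Where u is C¹ its divergence is continuous, so a nonzero value would persist on a neighbourhood,
which has positive measure. -/
lemma Mesh.divg_eq_zero_of_contDiffAt {u : E d → E d} {x : E d}
    (h : ∀ᵐ x ∂volume.restrict M.Ω, divg u x = 0) (hx : x ∈ M.Ω) (hu : ContDiffAt ℝ 1 u x) :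
    divg u x = 0 := by
  by_contra hne
  have h1 : ∀ᶠ z in nhds x, divg u z ≠ 0 ∧ z ∈ M.Ω :=
    ((continuousAt_divg hu).eventually_ne hne).and (M.isOpen_Ω.mem_nhds hx)
  rw [ae_restrict_iff' M.measurableSet_Ω, ae_iff] at h
  refine (Measure.measure_pos_of_mem_nhds volume h1).ne' (measure_mono_null ?_ h)
  intro z hz
  simpa [Classical.not_imp] using And.symm hz

lemma DivConformingSpaces.contDiffAt_of_mem_elem {u : E d → E d} (hu : u ∈ X.V)
    {K : Fin M.numElem} {x : E d} (hx : x ∈ M.elem K) : ContDiffAt ℝ 1 u x :=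
  (((X.piecewise_V u hu K).1.contDiffAt ((M.isOpen_elem K).mem_nhds hx)).of_le (by norm_num))

lemma LipOn.of_contDiff_hasCompactSupport {χ : E d → ℝ} (h : ContDiff ℝ ∞ χ)
    (hc : HasCompactSupport χ) (t : Set (E d)) : LipOn χ t :=
  have ⟨L, hL⟩ := ContDiff.lipschitzWith_of_hasCompactSupport hc h (by norm_num)
  ⟨L, hL.lipschitzOnWith⟩

/-! ### Tensor contractions -/

lemma contract_smul (c : ℝ) (A B : Matrix (Fin d) (Fin d) ℝ) :
    contract A (c • B) = c * contract A B := by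
  simp only [contract, Matrix.smul_apply, smul_eq_mul, Finset.mul_sum]
  exact Finset.sum_congr rfl fun i _ => Finset.sum_congr rfl fun j _ => by ring

lemma contract_self_nonneg (A : Matrix (Fin d) (Fin d) ℝ) : 0 ≤ contract A A :=
  Finset.sum_nonneg fun _ _ => Finset.sum_nonneg fun _ _ => mul_self_nonneg _

/-- Only the symmetric part contributes: A : (A + Aᵀ) = ½|A + Aᵀ|². -/
lemma contract_add_transpose_nonneg (A : Matrix (Fin d) (Fin d) ℝ) :
    0 ≤ contract A (A + A.transpose) := by
  have h : 2 * contract A (A + A.transpose) =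
      contract (A + A.transpose) (A + A.transpose) := by
    have h' : contract A (A + A.transpose) = contract A.transpose (A + A.transpose) := by
      rw [contract, Finset.sum_comm]
      simp only [contract, Matrix.add_apply, Matrix.transpose_apply]
      exact Finset.sum_congr rfl fun i _ => Finset.sum_congr rfl fun j _ => by ring
    calc 2 * contract A (A + A.transpose)
        = contract A (A + A.transpose) + contract A.transpose (A + A.transpose) := by
          rw [← h']; ring
      _ = _ := by
        simp only [contract, ← Finset.sum_add_distrib, Matrix.add_apply, add_mul]
  linarith [contract_self_nonneg (A + A.transpose)]

lemma contract_grad_outer (u : E d → E d) (x a b : E d) :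
    contract (grad u x) (outer a b) = dot a (fderiv ℝ u x b) := by
  have hb : b = ∑ j, b j • EuclideanSpace.single j (1 : ℝ) := by
    simpa using ((EuclideanSpace.basisFun (Fin d) ℝ).sum_repr b).symm
  conv_rhs => rw [hb]
  simp only [map_sum, map_smul, dot_eq_sum, contract, grad, outer, Matrix.of_apply,
    WithLp.ofLp_sum, Finset.sum_apply, PiLp.smul_apply, smul_eq_mul, Finset.mul_sum]
  exact Finset.sum_congr rfl fun i _ => Finset.sum_congr rfl fun j _ => by ring

/-! ### Dissipation -/

lemma viscousDissipation_nonneg : 0 ≤ viscousDissipation P M s s' := by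
  refine integral_nonneg fun x => ?_
  rw [Params.stress, contract_smul]
  exact mul_nonneg (mul_nonneg (one_div_nonneg.2 P.Re_pos.le) (P.mu_nonneg _))
    (contract_add_transpose_nonneg _)

/-- θ_K is a quotient of nonnegative quantities, and 0 when its denominator vanishes. Integrability
of θ_K is not needed, since a non-integrable function has integral 0. -/
lemma capturingDissipation_nonneg : 0 ≤ capturingDissipation P M Δt s s' := by
  refine Finset.sum_nonneg fun K _ => integral_nonneg fun x => ?_
  rw [contract_smul]
  exact mul_nonneg (div_nonneg (mul_nonneg (mul_nonneg P.C_nonneg (Real.sqrt_nonneg _))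
    (Real.sqrt_nonneg _)) (Real.sqrt_nonneg _)) (contract_self_nonneg _)

/-! ### The energy balance -/

lemma Params.y_eq (P : Params d) : P.y = innerSL ℝ P.jvec :=
  funext fun z => by simp [Params.y, real_inner_comm]

lemma Params.lipOn_y (t : Set (E d)) : LipOn P.y t :=
  P.y_eq ▸ ⟨_, (innerSL ℝ P.jvec).lipschitz.lipschitzOnWith⟩

lemma Params.hasFDerivAt_y (x : E d) : HasFDerivAt P.y (innerSL ℝ P.jvec) x :=
  P.y_eq ▸ (innerSL ℝ P.jvec).hasFDerivAt

lemma Mesh.Bdd.contract {A B : E d → Matrix (Fin d) (Fin d) ℝ}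
    (hA : ∀ i j, M.Bdd fun x => A x i j) (hB : ∀ i j, M.Bdd fun x => B x i j) :
    M.Bdd fun x => contract (A x) (B x) :=
  memLp_finsetSum _ fun i _ => memLp_finsetSum _ fun j _ => (hA i j).mul (hB i j)

lemma Mesh.Bdd.regNorm {ϵ : ℝ} (hϵ : 0 ≤ ϵ) {b : E d → E d} (hb : M.Bdd b) :
    M.Bdd fun x => regNorm ϵ (b x) := by
  have hc : Continuous fun v : E d => LevelSetNS.regNorm ϵ v := by
    unfold LevelSetNS.regNorm; fun_prop
  refine MemLp.of_le ((MemLp.norm hb).add (memLp_top_const ϵ))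
    (hc.comp_aestronglyMeasurable hb.aestronglyMeasurable) (Filter.Eventually.of_forall fun x => ?_)
  have h0 := norm_nonneg (b x)
  rw [LevelSetNS.regNorm, Real.norm_of_nonneg (Real.sqrt_nonneg _), Pi.add_apply,
    Real.norm_of_nonneg (by positivity), LevelSetNS.dot,
    real_inner_self_eq_norm_sq]
  exact Real.sqrt_le_iff.2 ⟨by positivity, by nlinarith⟩

/-- The convective, gravitational and density-transport terms of the momentum equation cancel. -/
lemma integral_convection_cancel {u : E d → E d} {φ : E d → ℝ}
    (hu : LipOn u (closure M.Ω)) (h0 : ∀ x ∈ frontier M.Ω, u x = 0)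
    (hdiv : ∀ᵐ x ∂volume.restrict M.Ω, divg u x = 0) (hφ : LipOn φ (closure M.Ω)) :
    (∫ x in M.Ω, contract (grad u x) (P.rho (φ x) • outer (u x) (u x)))
      - 1 / P.Fr ^ 2 * (∫ x in M.Ω, dot (u x) (P.rho (φ x) • P.jvec))
      + (∫ x in M.Ω, dot (u x)
          ((P.varrhoM (φ x) * (‖u x‖ ^ 2 / 2 - 1 / P.Fr ^ 2 * P.y x)) • gradient φ x)) = 0 := by
  have hΩ := M.isBounded_Ω.closure
  have hρ : LipOn (fun x => P.rho (φ x)) (closure M.Ω) := LipOn.comp P.lipschitzWith_rho hφ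
  have hk : LipOn (fun x => 1 / 2 * dot (u x) (u x) + -(1 / P.Fr ^ 2) * P.y x) (closure M.Ω) := by
    have hconst (c : ℝ) : LipOn (fun _ : E d => c) (closure M.Ω) :=
      ⟨0, (LipschitzWith.const c).lipschitzOnWith⟩
    exact ((hconst _).mul hΩ (LipOn.dot hΩ hu hu)).add ((hconst _).mul hΩ (P.lipOn_y _))
  have bu := M.bdd_of_lipOn hu
  have bρ := M.bdd_of_lipOn hρ
  have b1 : M.Bdd fun x => contract (grad u x) (P.rho (φ x) • outer (u x) (u x)) :=
    Mesh.Bdd.contract (M.bdd_grad hu) fun i j => bρ.mul ((bu.coord i).mul (bu.coord j))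
  have b2 : M.Bdd fun x => dot (u x) (P.rho (φ x) • P.jvec) := by
    simp only [dot, inner_smul_right]
    exact bρ.mul (bu.dot (memLp_top_const P.jvec))
  have b3 : M.Bdd fun x => dot (u x)
      ((P.varrhoM (φ x) * (‖u x‖ ^ 2 / 2 - 1 / P.Fr ^ 2 * P.y x)) • gradient φ x) := by
    have e (x : E d) : ‖u x‖ ^ 2 / 2 - 1 / P.Fr ^ 2 * P.y x =
        1 / 2 * dot (u x) (u x) + -(1 / P.Fr ^ 2) * P.y x := by
      rw [dot, real_inner_self_eq_norm_sq]; ring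
    simp only [e, dot, inner_smul_right]
    exact ((M.bdd_comp P.continuous_varrhoM hφ).mul (M.bdd_of_lipOn hk)).mul
      (bu.dot (M.bdd_gradient hφ))
  -- The right-hand 0 becomes ∫ u·∇g with g = ρ(φ)(½|u|² − y/Fr²). As ϱ_m = ρ'(φ), the product rule
  -- for ∇g reproduces the three integrands a.e.
  rw [← integral_const_mul, ← integral_sub b1.integrable (b2.const_mul _).integrable,
    ← integral_add (b1.sub (b2.const_mul _)).integrable b3.integrable,
    ← integral_dot_gradient_eq_zero M hu h0 hdiv (hρ.mul hΩ hk)]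
  refine integral_congr_ae ?_
  filter_upwards [M.ae_differentiableAt hu, M.ae_differentiableAt hφ] with x hux hφx
  have d1 := (P.hasDerivAt_rho (φ x)).comp_hasFDerivAt x hφx.hasFDerivAt
  have d2 := ((hux.hasFDerivAt.inner ℝ hux.hasFDerivAt).const_mul (1 / 2)).add
    ((P.hasFDerivAt_y x).const_mul (-(1 / P.Fr ^ 2)))
  have d3 : HasFDerivAt (fun x => P.rho (φ x) *
      (1 / 2 * dot (u x) (u x) + -(1 / P.Fr ^ 2) * P.y x)) _ x := d1.mul d2
  rw [dot_gradient, d3.fderiv]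
  simp only [contract_smul, contract_grad_outer, dot, inner_smul_right]
  have e1 : inner ℝ (u x) (gradient φ x) = fderiv ℝ φ x (u x) := dot_gradient φ x (u x)
  have e2 : inner ℝ P.jvec (u x) = inner ℝ (u x) P.jvec := real_inner_comm _ _
  have e3 : inner ℝ (fderiv ℝ u x (u x)) (u x) = inner ℝ (u x) (fderiv ℝ u x (u x)) :=
    real_inner_comm _ _
  simp [e1, e2, e3, fderivInnerCLM_apply]
  ring

/-- The discrete product rule leaves a remainder with ½u_{n+1}·u_n, rather than ½|u_{n+1/2}|²; this
is why that product is paired with ϱ_a in the auxiliary equation. -/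
lemma dot_momentumRate (x : E d) :
    dot (uMid s s' x) (momentumRate P Δt s s' x) =
      1 / Δt * (1 / 2 * P.rho (s'.φ x) * dot (s'.u x) (s'.u x)
        - 1 / 2 * P.rho (s.φ x) * dot (s.u x) (s.u x)
        + (P.rho (s'.φ x) - P.rho (s.φ x)) * (1 / 2 * dot (s'.u x) (s.u x))) := by
  simp only [uMid, momentumRate, dot, inner_smul_left, inner_smul_right, inner_add_left,
    inner_sub_right, real_inner_comm (s'.u x) (s.u x), RCLike.conj_to_real]
  ring

lemma gradient_sub_smul {f g : E d → ℝ} {x : E d} (hf : DifferentiableAt ℝ f x)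
    (hg : DifferentiableAt ℝ g x) (c : ℝ) :
    gradient (fun z => c * (g z - f z)) x = c • (gradient g x - gradient f x) := by
  have h : HasFDerivAt (fun z => c * (g z - f z)) (c • (fderiv ℝ g x - fderiv ℝ f x)) x :=
    (hg.hasFDerivAt.sub hf.hasFDerivAt).const_mul c
  rw [gradient, gradient, gradient, h.fderiv]
  simp

lemma regNorm_sq (ϵ : ℝ) (b : E d) : regNorm ϵ b ^ 2 = dot b b + ϵ ^ 2 :=
  Real.sq_sqrt (add_nonneg real_inner_self_nonneg (sq_nonneg ϵ))

/-- The discrete chain rule for the regularized norm; if both norms vanish, so do both sides. -/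
lemma dot_sub_avg (ϵ : ℝ) (a b : E d) :
    dot (b - a) ((1 / (1 / 2 * (regNorm ϵ a + regNorm ϵ b))) • ((1 / 2 : ℝ) • (a + b))) =
      regNorm ϵ b - regNorm ϵ a := by
  have ha : 0 ≤ regNorm ϵ a := Real.sqrt_nonneg _
  have hb : 0 ≤ regNorm ϵ b := Real.sqrt_nonneg _
  -- Difference of squares; ϵ² drops out.
  have key : dot (b - a) (a + b) =
      (regNorm ϵ b - regNorm ϵ a) * (regNorm ϵ a + regNorm ϵ b) := by
    have h1 := regNorm_sq ϵ a
    have h2 := regNorm_sq ϵ b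
    simp only [dot, inner_add_right, inner_sub_left, real_inner_comm a b] at h1 h2 ⊢
    linear_combination h1 - h2
  simp only [dot, inner_smul_right] at key ⊢
  rw [key]
  rcases (add_nonneg ha hb).eq_or_lt with h | h
  · have h1 : regNorm ϵ a = 0 := by linarith
    have h2 : regNorm ϵ b = 0 := by linarith
    simp [h1, h2]
  · field_simp

/-- The discrete energy identity. -/
theorem IsStep.energy_sub_div (hs : s.Mem X) (hs' : s'.Mem X) (h : IsStep P X Δt τ s s') :
    (energy P M s' - energy P M s) / Δt =
      -viscousDissipation P M s s' - capturingDissipation P M Δt s s' := by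
  have hΩ := M.isBounded_Ω.closure
  have hu := hs.uMid_mem hs'
  have hφ := hs.φMid_mem hs'
  have lu := X.lipschitz_V _ hu
  have lφ := X.lipschitz_S _ hφ
  have lu0 := X.lipschitz_V _ hs.1
  have lu1 := X.lipschitz_V _ hs'.1
  have lφ0 := X.lipschitz_S _ hs.2.2.1
  have lφ1 := X.lipschitz_S _ hs'.2.2.1
  have bu := M.bdd_of_lipOn lu
  have bu0 := M.bdd_of_lipOn lu0
  have bu1 := M.bdd_of_lipOn lu1
  have bφ0 := M.bdd_of_lipOn lφ0
  have bφ1 := M.bdd_of_lipOn lφ1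
  have bv := M.bdd_of_lipOn (X.lipschitz_S _ hs'.2.2.2)
  have bY := M.bdd_of_lipOn (P.lipOn_y (closure M.Ω))
  have bρ0 := M.bdd_of_lipOn (LipOn.comp P.lipschitzWith_rho lφ0)
  have bρ1 := M.bdd_of_lipOn (LipOn.comp P.lipschitzWith_rho lφ1)
  have bδ0 := M.bdd_comp (continuous_deltaEps P.ε) lφ0
  have bδ1 := M.bdd_comp (continuous_deltaEps P.ε) lφ1
  have bn0 := Mesh.Bdd.regNorm P.ϵ_nonneg (M.bdd_gradient lφ0)
  have bn1 := Mesh.Bdd.regNorm P.ϵ_nonneg (M.bdd_gradient lφ1)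
  have bK0 := (bρ0.const_mul (1 / 2)).mul (bu0.dot bu0)
  have bK1 := (bρ1.const_mul (1 / 2)).mul (bu1.dot bu1)
  have bR := (bρ1.sub bρ0).mul ((bu1.dot bu0).const_mul (1 / 2))
  have bG0 := bρ0.mul bY
  have bG1 := bρ1.mul bY
  have bS0 := bδ0.mul bn0
  have bS1 := bδ1.mul bn1
  have bB : M.Bdd fun x => s'.v x * (1 / Δt * (s'.φ x - s.φ x)) :=
    bv.mul ((bφ1.sub bφ0).const_mul _)
  have bA6 : M.Bdd fun x => dot (uMid s s' x) (s'.v x • gradient (φMid s s') x) := by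
    simp only [dot, inner_smul_right]
    exact bv.mul (bu.dot (M.bdd_gradient lφ))
  -- the momentum equation
  have hmom := h.momentum _ hu
  have hcont : ∫ x in M.Ω, divg (uMid s s') x * s'.p x = 0 := by
    simpa only [mul_comm] using h.continuity _ hs'.2.1
  have hibp := integral_convection_cancel (P := P) lu (X.boundary_V _ hu)
    (X.ae_divg_eq_zero hu h.continuity) lφ
  have hrate : ∫ x in M.Ω, dot (uMid s s' x) (momentumRate P Δt s s' x) =
      1 / Δt * (kineticEnergy P M s' - kineticEnergy P M s + ∫ x in M.Ω,
        (P.rho (s'.φ x) - P.rho (s.φ x)) * (1 / 2 * dot (s'.u x) (s.u x))) := by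
    rw [kineticEnergy, kineticEnergy, ← integral_sub bK1.integrable bK0.integrable,
      ← integral_add (bK1.sub bK0).integrable bR.integrable, ← integral_const_mul]
    exact integral_congr_ae (Filter.Eventually.of_forall dot_momentumRate)
  -- the level-set equation
  have hls := h.levelSet _ hs'.2.2.2
  have hB : (∫ x in M.Ω, s'.v x *
        ((s'.φ x - s.φ x) / Δt + dot (uMid s s' x) (gradient (φMid s s') x))) =
      (∫ x in M.Ω, s'.v x * (1 / Δt * (s'.φ x - s.φ x))) +
        ∫ x in M.Ω, dot (uMid s s' x) (s'.v x • gradient (φMid s s') x) := by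
    rw [← integral_add bB.integrable bA6.integrable]
    refine integral_congr_ae (Filter.Eventually.of_forall fun x => ?_)
    simp only [dot, inner_smul_right]
    ring
  -- the auxiliary equation
  have hζ : (fun x => 1 / Δt * (s'.φ x - s.φ x)) ∈ X.S :=
    X.S.smul_mem (1 / Δt) (X.S.sub_mem hs'.2.2.1 hs.2.2.1)
  have haux := h.auxiliary _ hζ
  have hC1 : (∫ x in M.Ω, 1 / Δt * (s'.φ x - s.φ x) * (s'.v x + P.varrhoA (s.φ x) (s'.φ x) *
        (1 / 2 * dot (s'.u x) (s.u x) - 1 / P.Fr ^ 2 * P.y x))) =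
      (∫ x in M.Ω, s'.v x * (1 / Δt * (s'.φ x - s.φ x))) + 1 / Δt *
        ((∫ x in M.Ω, (P.rho (s'.φ x) - P.rho (s.φ x)) * (1 / 2 * dot (s'.u x) (s.u x)))
          - (gravityEnergy P M s' - gravityEnergy P M s)) := by
    rw [gravityEnergy, gravityEnergy, ← mul_sub, ← integral_sub bG1.integrable bG0.integrable,
      ← integral_const_mul (1 / P.Fr ^ 2),
      ← integral_sub bR.integrable ((bG1.sub bG0).const_mul _).integrable,
      ← integral_const_mul (1 / Δt), ← integral_add bB.integrable
        ((bR.sub ((bG1.sub bG0).const_mul _)).const_mul _).integrable]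
    refine integral_congr_ae (Filter.Eventually.of_forall fun x => ?_)
    have := P.varrhoA_mul_sub (s.φ x) (s'.φ x)
    linear_combination (1 / Δt) *
      (1 / 2 * dot (s'.u x) (s.u x) - 1 / P.Fr ^ 2 * P.y x) * this
  have e2 (x : E d) : 1 / Δt * (s'.φ x - s.φ x) * P.varsigma (s.φ x) (s'.φ x) *
        gradNormAvg P s s' x = 1 / Δt * ((deltaEps P.ε (s'.φ x) - deltaEps P.ε (s.φ x)) *
          (1 / 2 * (regNorm P.ϵ (gradient s.φ x) + regNorm P.ϵ (gradient s'.φ x)))) := by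
    have := P.varsigma_mul_sub (s.φ x) (s'.φ x)
    rw [gradNormAvg]
    linear_combination (1 / Δt) *
      (1 / 2 * (regNorm P.ϵ (gradient s.φ x) + regNorm P.ϵ (gradient s'.φ x))) * this
  have e3 : (fun x => dot (deltaAvg P s s' x • gradient (fun x => 1 / Δt * (s'.φ x - s.φ x)) x)
        ((1 / gradNormAvg P s s' x) • gradAvg s s' x)) =ᵐ[volume.restrict M.Ω] fun x =>
      1 / Δt * (1 / 2 * (deltaEps P.ε (s.φ x) + deltaEps P.ε (s'.φ x)) *
        (regNorm P.ϵ (gradient s'.φ x) - regNorm P.ϵ (gradient s.φ x))) := by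
    filter_upwards [M.ae_differentiableAt lφ0, M.ae_differentiableAt lφ1] with x h0 h1
    have := dot_sub_avg P.ϵ (gradient s.φ x) (gradient s'.φ x)
    rw [gradient_sub_smul h0 h1, gradNormAvg, gradAvg, deltaAvg, ← this]
    simp only [dot, real_inner_smul_left]
    ring
  -- The product rule: jump of δ times mean norm, plus mean δ times jump of the norm, is the jump of
  -- δ‖∇φ‖.
  have hC23 : (∫ x in M.Ω, 1 / Δt * (s'.φ x - s.φ x) * P.varsigma (s.φ x) (s'.φ x) *
        gradNormAvg P s s' x) +
      (∫ x in M.Ω, dot (deltaAvg P s s' x • gradient (fun x => 1 / Δt * (s'.φ x - s.φ x)) x)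
        ((1 / gradNormAvg P s s' x) • gradAvg s s' x)) =
      1 / Δt * ((∫ x in M.Ω, deltaEps P.ε (s'.φ x) * regNorm P.ϵ (gradient s'.φ x)) -
        ∫ x in M.Ω, deltaEps P.ε (s.φ x) * regNorm P.ϵ (gradient s.φ x)) := by
    simp only [e2]
    rw [integral_congr_ae e3, ← integral_sub bS1.integrable bS0.integrable, ← integral_const_mul,
      ← integral_add (((bδ1.sub bδ0).mul ((bn0.add bn1).const_mul _)).const_mul _).integrable
        ((((bδ0.add bδ1).const_mul _).mul (bn1.sub bn0)).const_mul _).integrable]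
    exact integral_congr_ae (Filter.Eventually.of_forall fun x => by ring)
  rw [hcont, hrate] at hmom
  rw [hB] at hls
  rw [hC1] at haux
  rw [energy, energy, surfaceEnergy, surfaceEnergy, viscousDissipation, capturingDissipation]
  -- The stabilization sums in `hmom` and `hls` are identical with opposite signs, so they cancel
  -- unevaluated for any τ_K, integrable or not.
  linear_combination hmom + hls - haux + hibp - 1 / P.We * hC23

end LevelSetNS

/-! ### Density bounds, solenoidal velocity and energy decay -/

theorem mainTheorem1 (d : ℕ) (hd : d = 2 ∨ d = 3)
    (P : LevelSetNS.Params d) (M : LevelSetNS.Mesh d) (X : LevelSetNS.DivConformingSpaces M)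
    (N : ℕ) (t : ℕ → ℝ) (ht : ∀ n ≤ N, t n < t (n + 1))
    (τ : ℕ → Fin M.numElem → LevelSetNS.E d → ℝ)
    (s : ℕ → LevelSetNS.State d)
    (hs : ∀ n ≤ N + 1, (s n).Mem X)
    (hstep : ∀ n ≤ N, LevelSetNS.IsStep P X (t (n + 1) - t n) (τ n) (s n) (s (n + 1))) :
    -- maximum principle for the density
    (∀ n ≤ N + 1, ∀ x ∈ M.Ω, P.ρ₂ ≤ P.rho ((s n).φ x) ∧ P.rho ((s n).φ x) ≤ P.ρ₁) ∧
    -- the intermediate velocity is divergence-free, pointwise and as a distribution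
    (∀ n ≤ N,
      (∀ K, ∀ x ∈ M.elem K, LevelSetNS.divg (LevelSetNS.uMid (s n) (s (n + 1))) x = 0) ∧
      (∀ x ∈ M.Ω, ContDiffAt ℝ 1 (LevelSetNS.uMid (s n) (s (n + 1))) x →
        LevelSetNS.divg (LevelSetNS.uMid (s n) (s (n + 1))) x = 0) ∧
      (∀ χ : LevelSetNS.E d → ℝ, ContDiff ℝ ∞ χ → HasCompactSupport χ → tsupport χ ⊆ M.Ω →
        ∫ x in M.Ω, LevelSetNS.dot (LevelSetNS.uMid (s n) (s (n + 1)) x) (gradient χ x) = 0)) ∧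
    -- energy balance and dissipation
    (∀ n ≤ N,
      (LevelSetNS.energy P M (s (n + 1)) - LevelSetNS.energy P M (s n)) / (t (n + 1) - t n) =
        -LevelSetNS.viscousDissipation P M (s n) (s (n + 1))
          - LevelSetNS.capturingDissipation P M (t (n + 1) - t n) (s n) (s (n + 1)) ∧
      -LevelSetNS.viscousDissipation P M (s n) (s (n + 1))
          - LevelSetNS.capturingDissipation P M (t (n + 1) - t n) (s n) (s (n + 1)) ≤ 0) := by
  refine ⟨fun n _ x _ => P.rho_mem _, fun n hn => ?_, fun n hn => ⟨?_, ?_⟩⟩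
  · have hu := (hs n (by omega)).uMid_mem (hs (n + 1) (by omega))
    have hdiv := X.ae_divg_eq_zero hu (hstep n hn).continuity
    refine ⟨fun K x hx => ?_, fun x hx hc => M.divg_eq_zero_of_contDiffAt hdiv hx hc,
      fun χ hχ hcs _ => ?_⟩
    · exact M.divg_eq_zero_of_contDiffAt hdiv (M.elem_subset_Ω K hx) (X.contDiffAt_of_mem_elem hu hx)
    · exact LevelSetNS.integral_dot_gradient_eq_zero M (X.lipschitz_V _ hu) (X.boundary_V _ hu) hdiv
        (LevelSetNS.LipOn.of_contDiff_hasCompactSupport hχ hcs _)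
  · exact (hstep n hn).energy_sub_div (hs n (by omega)) (hs (n + 1) (by omega))
  · linarith [LevelSetNS.viscousDissipation_nonneg (P := P) (M := M) (s := s n) (s' := s (n + 1)),
      LevelSetNS.capturingDissipation_nonneg (P := P) (M := M) (Δt := t (n + 1) - t n) (s := s n)
        (s' := s (n + 1))]
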